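/- Let $d\ge 1$, let $D\subset\mathbb R^d$ be a nonempty bounded convex open set, and let $S\subset\mathbb R^d$ be the unit sphere with its surface measure. For those $x\in\partial D$ at which the outward unit normal $n(x)$ is well defined (i.e. unique) and $s\in S$, say $x\in\Gamma_\pm(s)$ if $\pm\, s\cdot n(x)>0$, and put $\Gamma_\pm=\{(x,s)\in\partial D\times S: x\in\Gamma_\pm(s)\}$. Let $\sigma$ be measurable on $D\times S$ with $0\le\sigma\le M<\infty$ almost everywhere. Let $H(s;D)=\{v\in L_2(D): s\cdot\nabla v\in L_2(D)\}$ and $H(D\times S)=\{v\in L_2(D\times S): s\cdot\nabla v\in L_2(D\times S)\}$ (weak derivatives), with the graph norms $\|v\|^2=\|v\|_{L_2}^2+\|s\cdot\nabla v\|_{L_2}^2$. Let $V(s)=H_{0,\Gamma_+(s)}(s;D)$ be the closure in $H(s;D)$ of $\{v\in C^1(\overline D): v|_{\Gamma_+(s)}=0\}$ and let $V=H_{0,+}(D\times S)$ be the closure in $H(D\times S)$ of $\{v\in C^1(\overline{D\times S}): v|_{\Gamma_+}=0\}$. Put $$a(w,v;s)=\int_D w\,(\sigma(\cdot,s)v-s\cdot\nabla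 v)\,dx,\qquad a(w,v)=\int_{D\times S}w\,(\sigma v-s\cdot\nabla v)\,dx\,ds,$$ and let $\mathcal T_s:L_2(D)\to V(s)'$, $(\mathcal T_s w)(v)=a(w,v;s)$, and $\mathcal T:L_2(D\times S)\to V'$, $(\mathcal T w)(v)=a(w,v)$, be the induced operators, with adjoints $\mathcal T_s^*v=\sigma(\cdot,s)v-s\cdot\nabla v$ and $\mathcal T^*v=\sigma v-s\cdot\nabla v$ (with values in $L_2$). Then there are constants $0<\underline c,\bar C<\infty$ such that the following holds for every $s\in S$ for which $\sigma(\cdot,s)$ is measurable with $0\le\sigma(\cdot,s)\le M$ almost everywhere on $D$ (this is the case for almost every $s\in S$, and for every $s\in S$ if $\sigma$ is measurable on $D\times S$ with $0\le\sigma\le M$ everywhere), with $\underline c,\bar C$ independent of $s$: 1. $\underline c\,\|v\|_{H(s;D)}\le\|\mathcal T_s^*v\|_{L_2(D)}\le\bar C\,\|v\|_{H(s;D)}$ for $v\in V(s)$. 2. With the graph norm on $V(s)$, $\mathcal T_s$ is boundedly invertible with $\|\mathcal T_s\|\le\bar C$ and $\|\mathcal T_s^{-1}\|\le\underline c^{-1}$.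 3. With the norm $\|\mathcal T_s^*v\|_{L_2(D)}$ on $V(s)$, $\mathcal T_s:L_2(D)\to V(s)'$ is an isometric isomorphism, so that $\kappa(\mathcal T_s)=\|\mathcal T_s\|\,\|\mathcal T_s^{-1}\|=1$. 4. For every $F\in V(s)'$ there is a unique $u\in L_2(D)$ with $a(u,v;s)=F(v)$ for all $v\in V(s)$; it depends linearly on $F$, and $\|u\|_{L_2(D)}\le\underline c^{-1}\|F\|$ in the dual of the graph norm. 5. There is a bounded trace operator from $V(s)$ to $L_2(\Gamma_-(s),|n\cdot s|)$, which on $C^1(\overline D)$ functions vanishing on $\Gamma_+(s)$ is the restriction to $\Gamma_-(s)$; and for every $f\in V(s)'$ and $g\in L_2(\Gamma_-(s),|n\cdot s|)$ there is a unique $u\in L_2(D)$ with $a(u,v;s)=\int_{\Gamma_-(s)}n\cdot s\;g\,v\,d\Gamma+f(v)$ for all $v\in V(s)$; it depends linearly and continuously on $(f,g)$. Statements 1 to 4 hold likewise, with the same constants $\underline c,\bar C$, for the lifted objects $\mathcal T$, $\mathcal T^*$, $V$, $H(D\times S)$, $L_2(D\times S)$ and $a(\cdot,\cdot)$. -/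

import Mathlib

open MeasureTheory Set Filter Topology
open scoped ENNReal ContDiff

noncomputable section

namespace RadTransport

/-! ### Graph spaces, the bilinear form and the transport operator over a measure space -/

section Abstract

variable {X : Type*} [MeasurableSpace X]

/-- `L₂(μ)`. -/
abbrev L2 (μ : Measure X) : Type _ := Lp ℝ 2 μ

/-- Pairs `(v, g) ∈ L₂ × L₂` with norm `(‖v‖² + ‖g‖²)^{1/2}`. The second entry is meant for the
directional derivative `s·∇v`, so that this is the graph norm. -/
def Pairs (μ : Measure X) : Type _ := WithLp 2 (L2 μ × L2 μ)

namespace Pairs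

variable {μ : Measure X}

instance : NormedAddCommGroup (Pairs μ) :=
  inferInstanceAs (NormedAddCommGroup (WithLp 2 (L2 μ × L2 μ)))

instance : InnerProductSpace ℝ (Pairs μ) :=
  inferInstanceAs (InnerProductSpace ℝ (WithLp 2 (L2 μ × L2 μ)))

instance : CompleteSpace (Pairs μ) :=
  inferInstanceAs (CompleteSpace (WithLp 2 (L2 μ × L2 μ)))

/-- The pair `(v, g)`. -/
def mk (v g : L2 μ) : Pairs μ := WithLp.toLp 2 (v, g)

/-- The first entry, as a bounded operator. -/
def fstL : Pairs μ →L[ℝ] L2 μ := WithLp.fstL 2 ℝ (L2 μ) (L2 μ)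

/-- The second entry, as a bounded operator. -/
def sndL : Pairs μ →L[ℝ] L2 μ := WithLp.sndL 2 ℝ (L2 μ) (L2 μ)

/-- The function `v` of a pair `(v, g)`. -/
def fst (p : Pairs μ) : L2 μ := fstL p

/-- The function `g` of a pair `(v, g)`. -/
def snd (p : Pairs μ) : L2 μ := sndL p

theorem fst_mk (v g : L2 μ) : (mk v g).fst = v := rfl

theorem snd_mk (v g : L2 μ) : (mk v g).snd = g := rfl

theorem ext' {p q : Pairs μ} (h1 : p.fst = q.fst) (h2 : p.snd = q.snd) : p = q :=
  (WithLp.ofLp_injective 2) (Prod.ext h1 h2)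

theorem norm_sq (p : Pairs μ) : ‖p‖ ^ 2 = ‖p.fst‖ ^ 2 + ‖p.snd‖ ^ 2 :=
  WithLp.prod_norm_sq_eq_of_L2 (α := L2 μ) (β := L2 μ) p

theorem add_fst (p q : Pairs μ) : (p + q).fst = p.fst + q.fst := map_add fstL p q

theorem add_snd (p q : Pairs μ) : (p + q).snd = p.snd + q.snd := map_add sndL p q

theorem smul_fst (c : ℝ) (p : Pairs μ) : (c • p).fst = c • p.fst := map_smul fstL c p

theorem smul_snd (c : ℝ) (p : Pairs μ) : (c • p).snd = c • p.snd := map_smul sndL c p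

theorem zero_fst : (0 : Pairs μ).fst = 0 := map_zero fstL

theorem zero_snd : (0 : Pairs μ).snd = 0 := map_zero sndL

end Pairs

variable {μ : Measure X}

/-- The bilinear form `a(w, v) = ∫ w (σ v - s·∇v)`, where `p = (v, s·∇v)`. -/
def transportForm (σ : X → ℝ) (w : L2 μ) (p : Pairs μ) : ℝ :=
  ∫ x, w x * (σ x * p.fst x - p.snd x) ∂μ

/-- `T^* v = σ v - s·∇v`, as a bounded operator from the graph space into `L₂`. -/
def adjTransport {σ : X → ℝ} (hσ : MemLp σ ∞ μ) : Pairs μ →L[ℝ] L2 μ :=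
  ((ContinuousLinearMap.mul ℝ ℝ).holderL μ ∞ 2 2 hσ.toLp).comp
    (Pairs.fstL) - Pairs.sndL

theorem adjTransport_coeFn {σ : X → ℝ} (hσ : MemLp σ ∞ μ) (p : Pairs μ) :
    adjTransport hσ p =ᵐ[μ] fun x => σ x * p.fst x - p.snd x := by
  have h1 : adjTransport hσ p
      = (ContinuousLinearMap.mul ℝ ℝ).holder 2 hσ.toLp p.fst - p.snd := rfl
  rw [h1]
  filter_upwards [Lp.coeFn_sub ((ContinuousLinearMap.mul ℝ ℝ).holder 2 hσ.toLp p.fst) p.snd,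
    (ContinuousLinearMap.mul ℝ ℝ).coeFn_holder (r := 2) hσ.toLp p.fst, hσ.coeFn_toLp]
    with x hx hy hz
  rw [hx, Pi.sub_apply, hy, hz]
  rfl

/-- `T^*` is the adjoint belonging to the bilinear form: `⟨w, T^* v⟩ = a(w, v)`. -/
theorem inner_adjTransport {σ : X → ℝ} (hσ : MemLp σ ∞ μ) (w : L2 μ) (p : Pairs μ) :
    inner ℝ w (adjTransport hσ p) = transportForm σ w p := by
  rw [L2.inner_def, transportForm]
  refine integral_congr_ae ?_
  filter_upwards [adjTransport_coeFn hσ p] with x hx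
  rw [hx]
  simp [mul_comm]

/-- A space `V` of pairs `(v, s·∇v)`, endowed with the graph norm. -/
def GraphNormed (V : Submodule ℝ (Pairs μ)) : Type _ := V

namespace GraphNormed

variable (V : Submodule ℝ (Pairs μ))

instance : NormedAddCommGroup (GraphNormed V) := inferInstanceAs (NormedAddCommGroup V)

instance : InnerProductSpace ℝ (GraphNormed V) := inferInstanceAs (InnerProductSpace ℝ V)

variable {V} in
/-- The pair `(v, s·∇v)`. -/
def pair (v : GraphNormed V) : Pairs μ := (show V from v).1

/-- The inclusion into the space of pairs. -/
def incl : GraphNormed V →L[ℝ] Pairs μ := V.subtypeL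

theorem incl_apply (v : GraphNormed V) : incl V v = v.pair := rfl

theorem norm_eq (v : GraphNormed V) : ‖v‖ = ‖v.pair‖ := rfl

end GraphNormed

/-- The same space `V`, endowed with the (semi)norm `‖T^* v‖` instead of the graph norm. -/
def StarNormed {σ : X → ℝ} (_hσ : MemLp σ ∞ μ) (V : Submodule ℝ (Pairs μ)) : Type _ := V

namespace StarNormed

variable {σ : X → ℝ} (hσ : MemLp σ ∞ μ) (V : Submodule ℝ (Pairs μ))

instance : AddCommGroup (StarNormed hσ V) := inferInstanceAs (AddCommGroup V)

instance : Module ℝ (StarNormed hσ V) := inferInstanceAs (Module ℝ V)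

variable {hσ V} in
/-- The pair `(v, s·∇v)`. -/
def pair (v : StarNormed hσ V) : Pairs μ := (show V from v).1

/-- `T^*` as a linear map on `V`. -/
def adj : StarNormed hσ V →ₗ[ℝ] L2 μ :=
  (adjTransport hσ).toLinearMap ∘ₗ (V.subtype : V →ₗ[ℝ] Pairs μ)

instance : SeminormedAddCommGroup (StarNormed hσ V) :=
  SeminormedAddCommGroup.induced (StarNormed hσ V) (L2 μ) (adj hσ V)

instance : NormedSpace ℝ (StarNormed hσ V) :=
  NormedSpace.induced ℝ (StarNormed hσ V) (L2 μ) (adj hσ V)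

theorem norm_eq (v : StarNormed hσ V) : ‖v‖ = ‖adjTransport hσ v.pair‖ := rfl

/-- `T^*` on `V` with the norm `‖T^* v‖`. -/
def adjL : StarNormed hσ V →L[ℝ] L2 μ :=
  (adj hσ V).mkContinuous 1 fun v => by rw [one_mul]; exact le_of_eq rfl

end StarNormed

/-- The transport operator `T : L₂ → V'`, `(T w)(v) = a(w, v)`, where `V` carries the
graph norm. -/
def transportOp {σ : X → ℝ} (hσ : MemLp σ ∞ μ) (V : Submodule ℝ (Pairs μ)) :
    L2 μ →L[ℝ] StrongDual ℝ (GraphNormed V) :=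
  (ContinuousLinearMap.precomp ℝ ((adjTransport hσ).comp (GraphNormed.incl V))).comp
    (innerSL ℝ (E := L2 μ))

theorem transportOp_apply {σ : X → ℝ} (hσ : MemLp σ ∞ μ) (V : Submodule ℝ (Pairs μ))
    (w : L2 μ) (v : GraphNormed V) : transportOp hσ V w v = transportForm σ w v.pair :=
  inner_adjTransport hσ w v.pair

/-- The transport operator `T : L₂ → V'`, `(T w)(v) = a(w, v)`, where `V` carries the
norm `‖T^* v‖`. -/
def transportOpStar {σ : X → ℝ} (hσ : MemLp σ ∞ μ) (V : Submodule ℝ (Pairs μ)) :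
    L2 μ →L[ℝ] StrongDual ℝ (StarNormed hσ V) :=
  (ContinuousLinearMap.precomp ℝ (StarNormed.adjL hσ V)).comp (innerSL ℝ (E := L2 μ))

theorem transportOpStar_apply {σ : X → ℝ} (hσ : MemLp σ ∞ μ) (V : Submodule ℝ (Pairs μ))
    (w : L2 μ) (v : StarNormed hσ V) :
    transportOpStar hσ V w v = transportForm σ w v.pair :=
  inner_adjTransport hσ w v.pair

/-- `σ` is measurable and `0 ≤ σ ≤ M` almost everywhere. -/
def IsCrossSection (μ : Measure X) (M : ℝ) (σ : X → ℝ) : Prop :=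
  AEStronglyMeasurable σ μ ∧ ∀ᵐ x ∂μ, 0 ≤ σ x ∧ σ x ≤ M

theorem IsCrossSection.memLp {M : ℝ} {σ : X → ℝ} (h : IsCrossSection μ M σ) : MemLp σ ∞ μ :=
  memLp_top_of_bound h.1 M <| h.2.mono fun x hx => by
    rw [Real.norm_eq_abs, abs_of_nonneg hx.1]; exact hx.2

/-- Integration against a fixed square integrable function. -/
def pairing (h : X → ℝ) (f : L2 μ) : ℝ := ∫ x, f x * h x ∂μ

theorem pairing_eq {h : X → ℝ} (hh : MemLp h 2 μ) (f : L2 μ) :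
    pairing h f = innerSL ℝ hh.toLp f := by
  rw [pairing, innerSL_apply_apply, L2.inner_def]
  refine integral_congr_ae ?_
  filter_upwards [hh.coeFn_toLp] with x hx
  rw [hx]
  simp

end Abstract

/-- The condition number `‖A‖ ‖A⁻¹‖`. -/
def condNumber {U W : Type*} [SeminormedAddCommGroup U] [NormedSpace ℝ U]
    [SeminormedAddCommGroup W]
    [NormedSpace ℝ W] (A : U ≃L[ℝ] W) : ℝ :=
  ‖(A : U →L[ℝ] W)‖ * ‖(A.symm : W →L[ℝ] U)‖

/-! ### Geometry -/

/-- `ℝᵈ`. -/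
abbrev E (d : ℕ) : Type := EuclideanSpace ℝ (Fin d)

/-- The unit sphere of directions. -/
abbrev Sph (d : ℕ) : Type := Metric.sphere (0 : E d) 1

variable {d : ℕ}

/-- `m` is a unit outward normal of the convex set `D` at `x`. -/
def IsOuterNormal (D : Set (E d)) (x m : E d) : Prop :=
  ‖m‖ = 1 ∧ ∀ y ∈ D, inner ℝ m (y - x) ≤ 0

/-- The outward normal of `D` is well defined at `x`. -/
def HasNormal (D : Set (E d)) (x : E d) : Prop := ∃! m, IsOuterNormal D x m

open Classical in
/-- The outward unit normal `n(x)` at the points where it is well defined. -/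
def normal (D : Set (E d)) (x : E d) : E d :=
  if h : HasNormal D x then h.choose else 0

/-- The outflow boundary `Γ₊(s)`. -/
def outflow (D : Set (E d)) (s : E d) : Set (E d) :=
  {x | x ∈ frontier D ∧ HasNormal D x ∧ 0 < inner ℝ s (normal D x)}

/-- The inflow boundary `Γ₋(s)`. -/
def inflow (D : Set (E d)) (s : E d) : Set (E d) :=
  {x | x ∈ frontier D ∧ HasNormal D x ∧ inner ℝ s (normal D x) < 0}

/-- Lebesgue measure on `D`. -/
abbrev domMeasure (D : Set (E d)) : Measure (E d) := volume.restrict D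

/-- Surface measure on the unit sphere. -/
abbrev sphMeasure (d : ℕ) : Measure (Sph d) := (volume : Measure (E d)).toSphere

/-- The product measure on `D × S`. -/
abbrev phaseMeasure (D : Set (E d)) : Measure (E d × Sph d) :=
  (domMeasure D).prod (sphMeasure d)

/-! ### The weighted measure `|n·s| dΓ` on the inflow boundary

The part of `∂D` where lines in direction `s` enter the convex set `D` is the graph, over the
projection of `D` along `s`, of the entry time `α`. Surface integrals are taken in this graph
parametrization, with surface element `√(1 + |∇α(y)|²) dy`. -/

/-- The hyperplane orthogonal to `s`. -/
abbrev Hyperplane (s : E d) : Submodule ℝ (E d) := (ℝ ∙ s)ᗮ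

/-- The projection of `D` along `s`. -/
def shadow (D : Set (E d)) (s : E d) : Set (Hyperplane s) :=
  {y | ∃ t : ℝ, (y : E d) + t • s ∈ D}

/-- The parameter at which the line `y + ℝ s` enters `D`. -/
def entryTime (D : Set (E d)) (s : E d) (y : Hyperplane s) : ℝ :=
  sInf {t : ℝ | (y : E d) + t • s ∈ D}

/-- The point at which the line `y + ℝ s` enters `D`. -/
def entryPoint (D : Set (E d)) (s : E d) (y : Hyperplane s) : E d :=
  (y : E d) + entryTime D s y • s

/-- The measure `|n·s| dΓ` on `Γ₋(s)`. -/
def inflowMeasure (D : Set (E d)) (s : E d) : Measure (E d) :=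
  ((volume.restrict {y | y ∈ shadow D s ∧ entryPoint D s y ∈ inflow D s}).withDensity fun y =>
    ENNReal.ofReal (|inner ℝ s (normal D (entryPoint D s y))| *
      √(1 + ‖fderiv ℝ (entryTime D s) y‖ ^ 2))).map (entryPoint D s)

/-! ### The fiber spaces -/

/-- `H(s;D)`: the pairs `(v, g) ∈ L₂(D)²` such that `g` is the weak derivative `s·∇v`. -/
def graphSpace (D : Set (E d)) (s : E d) : Submodule ℝ (Pairs (domMeasure D)) where
  carrier := {p | ∀ φ : E d → ℝ, ContDiff ℝ ∞ φ → HasCompactSupport φ → tsupport φ ⊆ D →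
    pairing (fun x => fderiv ℝ φ x s) p.fst = -pairing φ p.snd}
  add_mem' := by
    intro p q hp hq φ h1 h2 h3
    have m1 : MemLp (fun x => fderiv ℝ φ x s) 2 (domMeasure D) :=
      ((h1.continuous_fderiv (by simp)).clm_apply continuous_const).memLp_of_hasCompactSupport
        (h2.fderiv_apply ℝ s)
    have m2 : MemLp φ 2 (domMeasure D) := h1.continuous.memLp_of_hasCompactSupport h2
    have e1 := hp φ h1 h2 h3
    have e2 := hq φ h1 h2 h3
    rw [pairing_eq m1, pairing_eq m2] at e1 e2 ⊢
    rw [Pairs.add_fst, Pairs.add_snd, map_add, map_add, e1, e2]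
    ring
  zero_mem' := by
    intro φ h1 h2 h3
    have m1 : MemLp (fun x => fderiv ℝ φ x s) 2 (domMeasure D) :=
      ((h1.continuous_fderiv (by simp)).clm_apply continuous_const).memLp_of_hasCompactSupport
        (h2.fderiv_apply ℝ s)
    have m2 : MemLp φ 2 (domMeasure D) := h1.continuous.memLp_of_hasCompactSupport h2
    rw [pairing_eq m1, pairing_eq m2]
    simp [Pairs.zero_fst, Pairs.zero_snd]
  smul_mem' := by
    intro c p hp φ h1 h2 h3
    have m1 : MemLp (fun x => fderiv ℝ φ x s) 2 (domMeasure D) :=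
      ((h1.continuous_fderiv (by simp)).clm_apply continuous_const).memLp_of_hasCompactSupport
        (h2.fderiv_apply ℝ s)
    have m2 : MemLp φ 2 (domMeasure D) := h1.continuous.memLp_of_hasCompactSupport h2
    have e1 := hp φ h1 h2 h3
    rw [pairing_eq m1, pairing_eq m2] at e1 ⊢
    rw [Pairs.smul_fst, Pairs.smul_snd, map_smul, map_smul, e1]
    simp

/-- `φ ∈ C¹(closure D)` and `φ = 0` on `Γ₊(s)`. -/
def IsC1Test (D : Set (E d)) (s : E d) (φ : E d → ℝ) : Prop :=
  ContDiffOn ℝ 1 φ (closure D) ∧ ∀ x ∈ outflow D s, φ x = 0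

/-- `p` is the pair `(φ, s·∇φ)`, with the classical directional derivative. -/
def Represents (D : Set (E d)) (s : E d) (φ : E d → ℝ) (p : Pairs (domMeasure D)) : Prop :=
  p.fst =ᵐ[domMeasure D] φ ∧ ∀ᵐ x ∂domMeasure D, HasLineDerivAt ℝ φ (p.snd x) x s

theorem hasLineDerivAt_add {F : Type*} [AddCommGroup F] [Module ℝ F] {φ ψ : F → ℝ} {a b : ℝ}
    {x v : F} (h : HasLineDerivAt ℝ φ a x v) (h' : HasLineDerivAt ℝ ψ b x v) :
    HasLineDerivAt ℝ (φ + ψ) (a + b) x v :=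
  HasDerivAt.add h h'

theorem hasLineDerivAt_const_smul {F : Type*} [AddCommGroup F] [Module ℝ F] {φ : F → ℝ} {a : ℝ}
    {x v : F} (c : ℝ) (h : HasLineDerivAt ℝ φ a x v) :
    HasLineDerivAt ℝ (c • φ) (c * a) x v :=
  HasDerivAt.const_mul c h

/-- The functions in `C¹(closure D)` that vanish on `Γ₊(s)`, as a subspace of `H(s;D)`. -/
def c1Space (D : Set (E d)) (s : E d) : Submodule ℝ (Pairs (domMeasure D)) where
  carrier := {p | p ∈ graphSpace D s ∧ ∃ φ, IsC1Test D s φ ∧ Represents D s φ p}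
  add_mem' := by
    rintro p q ⟨hp, φ, hφ, hφp, hφd⟩ ⟨hq, ψ, hψ, hψq, hψd⟩
    refine ⟨add_mem hp hq, φ + ψ, ⟨hφ.1.add hψ.1, fun x hx => ?_⟩, ?_, ?_⟩
    · simp [hφ.2 x hx, hψ.2 x hx]
    · rw [Pairs.add_fst]
      exact (Lp.coeFn_add _ _).trans (hφp.add hψq)
    · rw [Pairs.add_snd]
      filter_upwards [Lp.coeFn_add p.snd q.snd, hφd, hψd] with x h1 h2 h3
      rw [h1]
      exact hasLineDerivAt_add h2 h3
  zero_mem' := by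
    refine ⟨zero_mem _, 0, ⟨contDiffOn_const, fun _ _ => rfl⟩, ?_, ?_⟩
    · exact Lp.coeFn_zero _ _ _
    · filter_upwards [Lp.coeFn_zero ℝ 2 (domMeasure D)] with x h1
      rw [Pairs.zero_snd, h1]
      exact hasDerivAt_const (0 : ℝ) (0 : ℝ)
  smul_mem' := by
    rintro c p ⟨hp, φ, hφ, hφp, hφd⟩
    refine ⟨Submodule.smul_mem _ c hp, c • φ, ⟨hφ.1.const_smul c, fun x hx => ?_⟩, ?_, ?_⟩
    · simp [hφ.2 x hx]
    · rw [Pairs.smul_fst]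
      exact (Lp.coeFn_smul _ _).trans (hφp.const_smul c)
    · rw [Pairs.smul_snd]
      filter_upwards [Lp.coeFn_smul c p.snd, hφd] with x h1 h2
      rw [h1]
      exact hasLineDerivAt_const_smul c h2

/-- `V(s) = H_{0,Γ₊(s)}(s;D)`, the closure in the graph norm. -/
def fiberSpace (D : Set (E d)) (s : E d) : Submodule ℝ (Pairs (domMeasure D)) :=
  (c1Space D s).topologicalClosure

/-! ### The lifted spaces -/

theorem memLp_restrict_sphere (D : Set (E d)) {φ : E d × E d → ℝ} (h1 : Continuous φ)
    (h2 : HasCompactSupport φ) :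
    MemLp (fun q : E d × Sph d => φ (q.1, (q.2 : E d))) 2 (phaseMeasure D) := by
  have hc : IsClosedEmbedding (fun q : E d × Sph d => (q.1, (q.2 : E d))) :=
    IsClosedEmbedding.id.prodMap Metric.isClosed_sphere.isClosedEmbedding_subtypeVal
  exact (h1.comp hc.continuous).memLp_of_hasCompactSupport (h2.comp_isClosedEmbedding hc)

theorem memLp_deriv_restrict_sphere (D : Set (E d)) {φ : E d × E d → ℝ} (h1 : ContDiff ℝ ∞ φ)
    (h2 : HasCompactSupport φ) :
    MemLp (fun q : E d × Sph d => fderiv ℝ φ (q.1, (q.2 : E d)) ((q.2 : E d), 0)) 2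
      (phaseMeasure D) :=
  memLp_restrict_sphere D (φ := fun z => fderiv ℝ φ z (z.2, 0))
    ((h1.continuous_fderiv (by simp)).clm_apply (continuous_snd.prodMk continuous_const))
    ((h2.fderiv ℝ).mono' fun z hz => subset_tsupport _ fun h0 => hz (by simp [h0]))

/-- `H(D×S)`: the pairs `(v, g) ∈ L₂(D×S)²` such that `g` is the weak derivative `s·∇v` on
`D × S`. Test functions on `D × S` are restrictions of test functions on `D × ℝᵈ`. -/
def liftedGraphSpace (D : Set (E d)) : Submodule ℝ (Pairs (phaseMeasure D)) where
  carrier := {p | ∀ φ : E d × E d → ℝ, ContDiff ℝ ∞ φ → HasCompactSupport φ →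
    tsupport φ ⊆ D ×ˢ univ →
    pairing (fun q : E d × Sph d => fderiv ℝ φ (q.1, (q.2 : E d)) ((q.2 : E d), 0)) p.fst
      = -pairing (fun q : E d × Sph d => φ (q.1, (q.2 : E d))) p.snd}
  add_mem' := by
    intro p q hp hq φ h1 h2 h3
    have e1 := hp φ h1 h2 h3
    have e2 := hq φ h1 h2 h3
    rw [pairing_eq (memLp_deriv_restrict_sphere D h1 h2),
      pairing_eq (memLp_restrict_sphere D h1.continuous h2)] at e1 e2 ⊢
    rw [Pairs.add_fst, Pairs.add_snd, map_add, map_add, e1, e2]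
    ring
  zero_mem' := by
    intro φ h1 h2 h3
    rw [pairing_eq (memLp_deriv_restrict_sphere D h1 h2),
      pairing_eq (memLp_restrict_sphere D h1.continuous h2)]
    simp [Pairs.zero_fst, Pairs.zero_snd]
  smul_mem' := by
    intro c p hp φ h1 h2 h3
    have e1 := hp φ h1 h2 h3
    rw [pairing_eq (memLp_deriv_restrict_sphere D h1 h2),
      pairing_eq (memLp_restrict_sphere D h1.continuous h2)] at e1 ⊢
    rw [Pairs.smul_fst, Pairs.smul_snd, map_smul, map_smul, e1]
    simp

/-- `φ` is `C¹` on `closure (D × S) = closure D × S` and vanishes on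
`Γ₊ = {(x, s) ∈ ∂D × S | s·n(x) > 0}`. -/
def IsLiftedC1Test (D : Set (E d)) (φ : E d × E d → ℝ) : Prop :=
  ContDiffOn ℝ 1 φ (closure D ×ˢ Metric.sphere (0 : E d) 1) ∧
    ∀ s ∈ Metric.sphere (0 : E d) 1, ∀ x ∈ outflow D s, φ (x, s) = 0

/-- `p` is the pair `(φ, s·∇φ)`, with the classical derivative in the space variable. -/
def LiftedRepresents (D : Set (E d)) (φ : E d × E d → ℝ) (p : Pairs (phaseMeasure D)) : Prop :=
  (p.fst =ᵐ[phaseMeasure D] fun q => φ (q.1, (q.2 : E d))) ∧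
    ∀ᵐ q ∂phaseMeasure D,
      HasLineDerivAt ℝ (fun y => φ (y, (q.2 : E d))) (p.snd q) q.1 (q.2 : E d)

/-- The functions in `C¹(closure (D × S))` that vanish on `Γ₊`, as a subspace of `H(D×S)`. -/
def liftedC1Space (D : Set (E d)) : Submodule ℝ (Pairs (phaseMeasure D)) where
  carrier := {p | p ∈ liftedGraphSpace D ∧ ∃ φ, IsLiftedC1Test D φ ∧ LiftedRepresents D φ p}
  add_mem' := by
    rintro p q ⟨hp, φ, hφ, hφp, hφd⟩ ⟨hq, ψ, hψ, hψq, hψd⟩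
    refine ⟨add_mem hp hq, φ + ψ, ⟨hφ.1.add hψ.1, fun s hs x hx => ?_⟩, ?_, ?_⟩
    · simp [hφ.2 s hs x hx, hψ.2 s hs x hx]
    · rw [Pairs.add_fst]
      exact (Lp.coeFn_add _ _).trans (hφp.add hψq)
    · rw [Pairs.add_snd]
      filter_upwards [Lp.coeFn_add p.snd q.snd, hφd, hψd] with x h1 h2 h3
      rw [h1]
      exact hasLineDerivAt_add h2 h3
  zero_mem' := by
    refine ⟨zero_mem _, 0, ⟨contDiffOn_const, fun _ _ _ _ => rfl⟩, ?_, ?_⟩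
    · exact Lp.coeFn_zero _ _ _
    · filter_upwards [Lp.coeFn_zero ℝ 2 (phaseMeasure D)] with x h1
      rw [Pairs.zero_snd, h1]
      exact hasDerivAt_const (0 : ℝ) (0 : ℝ)
  smul_mem' := by
    rintro c p ⟨hp, φ, hφ, hφp, hφd⟩
    refine ⟨Submodule.smul_mem _ c hp, c • φ, ⟨hφ.1.const_smul c, fun s hs x hx => ?_⟩, ?_, ?_⟩
    · simp [hφ.2 s hs x hx]
    · rw [Pairs.smul_fst]
      exact (Lp.coeFn_smul _ _).trans (hφp.const_smul c)
    · rw [Pairs.smul_snd]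
      filter_upwards [Lp.coeFn_smul c p.snd, hφd] with x h1 h2
      rw [h1]
      exact hasLineDerivAt_const_smul c h2

/-- `V = H_{0,+}(D×S)`, the closure in the graph norm. -/
def liftedSpace (D : Set (E d)) : Submodule ℝ (Pairs (phaseMeasure D)) :=
  (liftedC1Space D).topologicalClosure

/-! `H(s;D)` and `H(D×S)` are closed, hence contain the closures taken above. -/

theorem continuous_pairing {X : Type*} [MeasurableSpace X] {μ : Measure X} {h : X → ℝ}
    (hh : MemLp h 2 μ) : Continuous (pairing (μ := μ) h) := by
  rw [show pairing (μ := μ) h = innerSL ℝ hh.toLp from funext (pairing_eq hh)]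
  exact (innerSL ℝ hh.toLp).continuous

theorem fiberSpace_le_graphSpace (D : Set (E d)) (s : E d) :
    fiberSpace D s ≤ graphSpace D s := by
  refine Submodule.topologicalClosure_minimal _ (fun p hp => hp.1) ?_
  have : (graphSpace D s : Set (Pairs (domMeasure D))) = ⋂ (φ : E d → ℝ)
      (_ : ContDiff ℝ ∞ φ) (_ : HasCompactSupport φ) (_ : tsupport φ ⊆ D),
      {p | pairing (fun x => fderiv ℝ φ x s) p.fst = -pairing φ p.snd} := by
    ext p; simp only [mem_iInter]; rfl
  rw [this]
  refine isClosed_iInter fun φ => isClosed_iInter fun h1 => isClosed_iInter fun h2 =>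
    isClosed_iInter fun _ => isClosed_eq ?_ ?_
  · exact (continuous_pairing
      (((h1.continuous_fderiv (by simp)).clm_apply continuous_const).memLp_of_hasCompactSupport
        (h2.fderiv_apply ℝ s))).comp Pairs.fstL.continuous
  · exact ((continuous_pairing (h1.continuous.memLp_of_hasCompactSupport h2)).comp
      Pairs.sndL.continuous).neg

theorem liftedSpace_le_liftedGraphSpace (D : Set (E d)) :
    liftedSpace D ≤ liftedGraphSpace D := by
  refine Submodule.topologicalClosure_minimal _ (fun p hp => hp.1) ?_
  have : (liftedGraphSpace D : Set (Pairs (phaseMeasure D))) = ⋂ (φ : E d × E d → ℝ)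
      (_ : ContDiff ℝ ∞ φ) (_ : HasCompactSupport φ) (_ : tsupport φ ⊆ D ×ˢ univ),
      {p | pairing (fun q : E d × Sph d => fderiv ℝ φ (q.1, (q.2 : E d)) ((q.2 : E d), 0)) p.fst
      = -pairing (fun q : E d × Sph d => φ (q.1, (q.2 : E d))) p.snd} := by
    ext p; simp only [mem_iInter]; rfl
  rw [this]
  refine isClosed_iInter fun φ => isClosed_iInter fun h1 => isClosed_iInter fun h2 =>
    isClosed_iInter fun _ => isClosed_eq ?_ ?_
  · exact (continuous_pairing (memLp_deriv_restrict_sphere D h1 h2)).comp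
      Pairs.fstL.continuous
  · exact ((continuous_pairing (memLp_restrict_sphere D h1.continuous h2)).comp
      Pairs.sndL.continuous).neg

end RadTransport

end

open RadTransport

/-!
The adjoint operator `T^* v = σ v - s·∇v` is an isomorphism of `V` onto `L₂`, with bounds that
depend only on `diam D` and `M`; all the assertions about `T` follow from this by transposition
and the Riesz representation theorem. It rests on two facts.

*Lower bound.* Let `φ ∈ C¹(closure D)` vanish on `Γ₊(s)`. A line in direction `s` leaves `D` at a
point that may have many normals, but it is a limit of points of `Γ₊(s)`: the balls in `D` centred
near the exit point touch the boundary at points where the normal is unique and has `s·n > 0`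
(`mem_closure_outflow`). So `φ` vanishes at all exit points, and integrating `(φ²)' = 2 φ s·∇φ`
up to the exit point bounds `φ²` by the integral of `-2 φ s·∇φ ≤ 2 φ T^* φ` along the ray, because
`σ ≥ 0`. Integrated over `D` this gives `‖φ‖ ≤ 2 diam D ‖T^* φ‖` (`IsC1Test.lintegral_sq_le_of_ae`
and `norm_le_of_lintegral_sq_le`), uniformly in `s` and in `σ`. The lifted inequality is its
integral over the sphere. Started at the entry points, and integrated over the projection of `D`
along `s`, the same estimate bounds the trace on `Γ₋(s)`; the measure `|n·s| dΓ` is at most the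
image of the Lebesgue measure of the projection (`inflow_density_le_one`).

*Dense range.* For `σ = 0` every test function `g` is `-s·∇v` with `v(x) = ∫ g(x + τ s) dτ`, which
is `C¹` and vanishes on `Γ₊(s)`, so a function orthogonal to the range of `T^*` is zero. As the
lower bound is uniform over all cross sections with values in `[0, M]`, the method of continuity
along `t σ`, `0 ≤ t ≤ 1`, carries surjectivity from `σ = 0` to the given cross section
(`IsTransportSpace.adjL_surjective`).

The structure `IsTransportSpace` collects what the functional analytic part needs of `V`, so that
the fibers and the lifted problem are treated together.
-/

namespace RadTransport

/-! ### Solvability for an abstract transport space -/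

noncomputable section AbstractSolvability

variable {X : Type*} [MeasurableSpace X] {μ : Measure X} {M : ℝ}

theorem IsCrossSection.smul {σ : X → ℝ} (h : IsCrossSection μ M σ) {t : ℝ} (h0 : 0 ≤ t)
    (h1 : t ≤ 1) : IsCrossSection μ M fun x => t * σ x := by
  refine ⟨h.1.const_mul t, h.2.mono fun x hx => ⟨mul_nonneg h0 hx.1, ?_⟩⟩
  nlinarith [hx.1, hx.2]

/-- The bound `‖σ v‖ ≤ |M| ‖v‖`, with `σ v` written as `T^* v + s·∇v`. -/
theorem IsCrossSection.norm_adjTransport_add_snd_le {σ : X → ℝ} (h : IsCrossSection μ M σ)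
    (p : Pairs μ) :
    ‖adjTransport h.memLp p + p.snd‖ ≤ |M| * ‖p.fst‖ := by
  refine Lp.norm_le_mul_norm_of_ae_le_mul ?_
  filter_upwards [adjTransport_coeFn h.memLp p, h.2,
    Lp.coeFn_add (adjTransport h.memLp p) p.snd] with x hx h2 h3
  rw [h3, Pi.add_apply, hx, sub_add_cancel, norm_mul, Real.norm_eq_abs, abs_of_nonneg h2.1]
  exact mul_le_mul_of_nonneg_right (h2.2.trans (le_abs_self M)) (norm_nonneg _)

theorem Pairs.norm_fst_le (p : Pairs μ) : ‖p.fst‖ ≤ ‖p‖ :=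
  abs_le_of_sq_le_sq' (by rw [p.norm_sq]; nlinarith [sq_nonneg ‖p.snd‖]) (norm_nonneg _) |>.2

theorem Pairs.norm_snd_le (p : Pairs μ) : ‖p.snd‖ ≤ ‖p‖ :=
  abs_le_of_sq_le_sq' (by rw [p.norm_sq]; nlinarith [sq_nonneg ‖p.fst‖]) (norm_nonneg _) |>.2

theorem Pairs.norm_le_add (p : Pairs μ) : ‖p‖ ≤ ‖p.fst‖ + ‖p.snd‖ := by
  refine abs_le_of_sq_le_sq' ?_ (by positivity) |>.2
  rw [p.norm_sq]
  nlinarith [norm_nonneg p.fst, norm_nonneg p.snd]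

theorem norm_adjTransport_le {σ : X → ℝ} (h : IsCrossSection μ M σ) (p : Pairs μ) :
    ‖adjTransport h.memLp p‖ ≤ (1 + |M|) * ‖p‖ := by
  have h1 : adjTransport h.memLp p = (adjTransport h.memLp p + p.snd) - p.snd := by abel
  rw [h1]
  nlinarith [norm_sub_le (adjTransport h.memLp p + p.snd) p.snd, h.norm_adjTransport_add_snd_le p,
    p.norm_fst_le, p.norm_snd_le, mul_le_mul_of_nonneg_left p.norm_fst_le (abs_nonneg M)]

/-- The coercivity constant belonging to a Poincaré constant `K` and a bound `M` for `σ`. -/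
def coercivityConst (K M : ℝ) : ℝ := (1 + K + |M| * K)⁻¹

theorem coercivityConst_pos {K : ℝ} (hK : 0 ≤ K) (M : ℝ) : 0 < coercivityConst K M := by
  unfold coercivityConst; positivity

/-- Control of `v` by `T^* v` gives control of `s·∇v = σ v - T^* v`, hence of the graph norm. -/
theorem coercivityConst_mul_norm_le {σ : X → ℝ} (h : IsCrossSection μ M σ) {K : ℝ} (hK : 0 ≤ K)
    {p : Pairs μ}
    (hp : ‖p.fst‖ ≤ K * ‖adjTransport h.memLp p‖) :
    coercivityConst K M * ‖p‖ ≤ ‖adjTransport h.memLp p‖ := by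
  have h2 : p.snd = (adjTransport h.memLp p + p.snd) - adjTransport h.memLp p := by abel
  have h3 : ‖p.snd‖ ≤ |M| * ‖p.fst‖ + ‖adjTransport h.memLp p‖ := by
    conv_lhs => rw [h2]
    exact (norm_sub_le _ _).trans (add_le_add_left (h.norm_adjTransport_add_snd_le p) _)
  unfold coercivityConst
  rw [inv_mul_le_iff₀ (by positivity)]
  nlinarith [p.norm_le_add, mul_le_mul_of_nonneg_left hp (abs_nonneg M)]

/-- The range of a bounded operator that is bounded below on a complete space is everything once
its orthogonal complement is trivial. -/
theorem surjective_of_orthogonal_eq_zero {H₁ H₂ : Type*} [NormedAddCommGroup H₁]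
    [NormedSpace ℝ H₁] [CompleteSpace H₁] [NormedAddCommGroup H₂] [InnerProductSpace ℝ H₂]
    [CompleteSpace H₂] (B : H₁ →L[ℝ] H₂) {c : ℝ} (hc : 0 < c) (hB : ∀ v, c * ‖v‖ ≤ ‖B v‖)
    (h0 : ∀ w : H₂, (∀ v, inner ℝ w (B v) = 0) → w = 0) : Function.Surjective B := by
  have ha : AntilipschitzWith (Real.toNNReal c⁻¹) B := by
    refine B.antilipschitz_of_bound fun v => ?_
    rw [Real.coe_toNNReal _ (by positivity), inv_mul_eq_div, le_div_iff₀ hc, mul_comm]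
    exact hB v
  have hcl : IsClosed (Set.range B) := ha.isClosed_range B.uniformContinuous
  have hcl' : IsClosed ((LinearMap.range B.toLinearMap : Submodule ℝ H₂) : Set H₂) := by
    rwa [LinearMap.coe_range]
  have : CompleteSpace (LinearMap.range B.toLinearMap : Submodule ℝ H₂) :=
    hcl'.completeSpace_coe
  have hbot : (LinearMap.range B.toLinearMap : Submodule ℝ H₂)ᗮ = ⊥ := by
    rw [Submodule.eq_bot_iff]
    intro w hw
    refine h0 w fun v => ?_
    rw [real_inner_comm]
    exact (Submodule.mem_orthogonal _ _).1 hw _ ⟨v, rfl⟩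
  have htop := (Submodule.orthogonal_eq_bot_iff).1 hbot
  exact LinearMap.range_eq_top.1 htop

/-- The spaces have to be nonzero: between zero spaces the operator norms are `0`. -/
theorem condNumber_eq_one {U W : Type*} [NormedAddCommGroup U]
    [NormedSpace ℝ U] [Nontrivial U] [SeminormedAddCommGroup W] [NormedSpace ℝ W]
    (A : U ≃ₗᵢ[ℝ] W) : condNumber A.toContinuousLinearEquiv = 1 := by
  have h1 : ‖(A.toContinuousLinearEquiv : U →L[ℝ] W)‖ = 1 :=
    A.toLinearIsometry.norm_toContinuousLinearMap
  have h2 : ‖(A.toContinuousLinearEquiv.symm : W →L[ℝ] U)‖ = 1 := by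
    refine le_antisymm (A.symm.toLinearIsometry.norm_toContinuousLinearMap_le) ?_
    obtain ⟨u, hu⟩ := exists_ne (0 : U)
    have h3 := (A.toContinuousLinearEquiv.symm : W →L[ℝ] U).le_opNorm (A u)
    have h4 : (A.toContinuousLinearEquiv.symm : W →L[ℝ] U) (A u) = u := A.symm_apply_apply u
    rw [h4, A.norm_map] at h3
    exact le_of_mul_le_mul_right (by rwa [one_mul]) (norm_pos_iff.2 hu)
  rw [condNumber, h1, h2, one_mul]

/-- A closed space `V` of pairs `(v, s·∇v)` on which `v` is controlled by `T^* v`, uniformly over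
the cross sections bounded by `M`, and on which the derivatives `s·∇v` are dense in `L₂`. -/
structure IsTransportSpace (M K : ℝ) (V : Submodule ℝ (Pairs μ)) : Prop where
  nonneg : 0 ≤ K
  closed : IsClosed (V : Set (Pairs μ))
  poincare : ∀ {σ : X → ℝ} (h : IsCrossSection μ M σ), ∀ p ∈ V,
    ‖p.fst‖ ≤ K * ‖adjTransport h.memLp p‖
  dense : ∀ w : L2 μ, (∀ p ∈ V, inner ℝ w p.snd = 0) → w = 0

namespace IsTransportSpace

variable {K : ℝ} {V : Submodule ℝ (Pairs μ)}

/-- `T^*` on `V` with the graph norm. -/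
def adjL {σ : X → ℝ} (h : IsCrossSection μ M σ) (V : Submodule ℝ (Pairs μ)) :
    GraphNormed V →L[ℝ] L2 μ :=
  (adjTransport h.memLp).comp (GraphNormed.incl V)

theorem completeSpace (hV : IsTransportSpace M K V) : CompleteSpace (GraphNormed V) :=
  hV.closed.completeSpace_coe

theorem adjL_bound (hV : IsTransportSpace M K V) {σ : X → ℝ} (h : IsCrossSection μ M σ)
    (v : GraphNormed V) : coercivityConst K M * ‖v‖ ≤ ‖adjL h V v‖ :=
  coercivityConst_mul_norm_le h hV.nonneg (hV.poincare h v.pair (show V from v).2)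

/-- Surjectivity of `T^*` passes from `r σ` to `t σ` when `|t - r| M K < 1`: a function `w`
orthogonal to the range of the second operator is tested with the solution `v` of the first
equation with right hand side `w`. -/
theorem adjL_surjective_step (hV : IsTransportSpace M K V) {σ : X → ℝ}
    (h : IsCrossSection μ M σ) {r t : ℝ} (hr0 : 0 ≤ r) (hr1 : r ≤ 1) (ht0 : 0 ≤ t) (ht1 : t ≤ 1)
    (hrt : |t - r| * (|M| * K) < 1) (hs : Function.Surjective (adjL (h.smul hr0 hr1) V)) :
    Function.Surjective (adjL (h.smul ht0 ht1) V) := by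
  have := hV.completeSpace
  refine surjective_of_orthogonal_eq_zero _ (coercivityConst_pos hV.nonneg M)
    (hV.adjL_bound _) fun w hw => ?_
  obtain ⟨v, hv⟩ := hs w
  have h1 : adjL (h.smul ht0 ht1) V v
      = w + (t - r) • (adjTransport h.memLp v.pair + v.pair.snd) := by
    rw [← hv]
    refine Lp.ext ?_
    filter_upwards [adjTransport_coeFn (h.smul ht0 ht1).memLp v.pair,
      adjTransport_coeFn (h.smul hr0 hr1).memLp v.pair, adjTransport_coeFn h.memLp v.pair,
      Lp.coeFn_add (adjL (h.smul hr0 hr1) V v)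
        ((t - r) • (adjTransport h.memLp v.pair + v.pair.snd)),
      Lp.coeFn_smul (t - r) (adjTransport h.memLp v.pair + v.pair.snd),
      Lp.coeFn_add (adjTransport h.memLp v.pair) v.pair.snd] with x e1 e2 e3 e4 e5 e6
    rw [e4, Pi.add_apply, e5, Pi.smul_apply, e6, Pi.add_apply, e3]
    change adjTransport (h.smul ht0 ht1).memLp v.pair x
      = adjTransport (h.smul hr0 hr1).memLp v.pair x + _
    rw [e1, e2, smul_eq_mul]
    ring
  have h2 : ‖v.pair.fst‖ ≤ K * ‖w‖ := by
    rw [← hv]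
    exact hV.poincare (h.smul hr0 hr1) v.pair (show V from v).2
  have h3 := hw v
  rw [h1, inner_add_right, inner_smul_right, real_inner_self_eq_norm_sq] at h3
  have h4 : |(t - r) * inner ℝ w (adjTransport h.memLp v.pair + v.pair.snd)|
      ≤ |t - r| * (‖w‖ * (|M| * (K * ‖w‖))) := by
    rw [abs_mul]
    refine mul_le_mul_of_nonneg_left ((abs_real_inner_le_norm _ _).trans ?_) (abs_nonneg _)
    exact mul_le_mul_of_nonneg_left ((h.norm_adjTransport_add_snd_le _).trans
      (mul_le_mul_of_nonneg_left h2 (abs_nonneg M))) (norm_nonneg w)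
  have h5 := (abs_le.1 h4).1
  by_contra hne
  have h6 : 0 < ‖w‖ ^ 2 := by have := norm_pos_iff.2 hne; positivity
  nlinarith

/-- For `σ = 0` the operator `T^*` is `-s·∇`, and its range is dense by assumption. -/
theorem adjL_surjective_zero (hV : IsTransportSpace M K V) {σ : X → ℝ}
    (h : IsCrossSection μ M σ) :
    Function.Surjective (adjL (h.smul le_rfl zero_le_one) V) := by
  have := hV.completeSpace
  refine surjective_of_orthogonal_eq_zero _ (coercivityConst_pos hV.nonneg M)
    (hV.adjL_bound _) fun w hw => hV.dense w fun p hp => ?_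
  have h1 : adjL (h.smul le_rfl zero_le_one) V (⟨p, hp⟩ : V) = -p.snd := by
    refine Lp.ext ?_
    filter_upwards [adjTransport_coeFn (h.smul le_rfl zero_le_one).memLp p,
      Lp.coeFn_neg p.snd] with x e1 e2
    rw [e2]
    refine Eq.trans e1 ?_
    simp
  have h2 := hw (⟨p, hp⟩ : V)
  rw [h1, inner_neg_right, neg_eq_zero] at h2
  exact h2

/-- Method of continuity along the cross sections `t σ`, `0 ≤ t ≤ 1`. -/
theorem adjL_surjective (hV : IsTransportSpace M K V) {σ : X → ℝ} (h : IsCrossSection μ M σ) :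
    Function.Surjective (adjL h V) := by
  obtain ⟨N, hN⟩ := exists_nat_gt (|M| * K)
  have hK := hV.nonneg
  have hN0 : (0 : ℝ) < N := lt_of_le_of_lt (by positivity) hN
  have key : ∀ k : ℕ, k ≤ N → ∀ (h0 : (0 : ℝ) ≤ k / N) (h1 : (k : ℝ) / N ≤ 1),
      Function.Surjective (adjL (h.smul h0 h1) V) := by
    intro k
    induction k with
    | zero =>
      intro _ h0 h1
      convert hV.adjL_surjective_zero h using 3; simp
    | succ k ih =>
      intro hk h0 h1
      have hkN : (k : ℝ) / N ≤ 1 := by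
        rw [div_le_one hN0]; exact_mod_cast (Nat.le_succ k).trans hk
      refine hV.adjL_surjective_step h (by positivity) hkN h0 h1 ?_
        (ih ((Nat.le_succ k).trans hk) (by positivity) hkN)
      have : ((k + 1 : ℕ) : ℝ) / N - k / N = 1 / N := by push_cast; ring
      rw [this, abs_of_pos (by positivity), one_div, inv_mul_lt_iff₀ hN0]
      simpa using hN
  have hl := key N le_rfl (by positivity) (by rw [div_self hN0.ne'])
  convert hl using 3; simp [div_self hN0.ne']

/-- `T^*` as an isomorphism from `V`, with the graph norm, onto `L₂`. -/
def adjEquiv (hV : IsTransportSpace M K V) {σ : X → ℝ} (h : IsCrossSection μ M σ) :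
    GraphNormed V ≃L[ℝ] L2 μ :=
  haveI := hV.completeSpace
  ContinuousLinearEquiv.ofBijective (adjL h V)
    (LinearMap.ker_eq_bot.2 (by
      refine (injective_iff_map_eq_zero (adjL h V)).2 fun v hv => ?_
      have h1 := hV.adjL_bound h v
      rw [hv, norm_zero] at h1
      have h2 := coercivityConst_pos hV.nonneg M
      exact norm_le_zero_iff.1 (nonpos_of_mul_nonpos_right h1 h2)))
    (LinearMap.range_eq_top.2 (hV.adjL_surjective h))

theorem adjEquiv_apply (hV : IsTransportSpace M K V) {σ : X → ℝ} (h : IsCrossSection μ M σ)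
    (v : GraphNormed V) : hV.adjEquiv h v = adjTransport h.memLp v.pair := rfl

theorem norm_adjEquiv_symm_le (hV : IsTransportSpace M K V) {σ : X → ℝ}
    (h : IsCrossSection μ M σ) (w : L2 μ) :
    ‖(hV.adjEquiv h).symm w‖ ≤ (coercivityConst K M)⁻¹ * ‖w‖ := by
  have h1 := hV.adjL_bound h ((hV.adjEquiv h).symm w)
  have h2 : adjL h V ((hV.adjEquiv h).symm w) = w := (hV.adjEquiv h).apply_symm_apply w
  rw [h2] at h1
  rwa [inv_mul_eq_div, le_div_iff₀ (coercivityConst_pos hV.nonneg M), mul_comm]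

theorem norm_comp_adjEquiv_symm_le (hV : IsTransportSpace M K V) {σ : X → ℝ}
    (h : IsCrossSection μ M σ) (F : StrongDual ℝ (GraphNormed V)) :
    ‖F.comp ((hV.adjEquiv h).symm : L2 μ →L[ℝ] GraphNormed V)‖
      ≤ (coercivityConst K M)⁻¹ * ‖F‖ := by
  have hc := coercivityConst_pos hV.nonneg M
  refine ContinuousLinearMap.opNorm_le_bound _ (by positivity) fun w => ?_
  calc ‖F ((hV.adjEquiv h).symm w)‖ ≤ ‖F‖ * ‖(hV.adjEquiv h).symm w‖ := F.le_opNorm _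
    _ ≤ ‖F‖ * ((coercivityConst K M)⁻¹ * ‖w‖) :=
      mul_le_mul_of_nonneg_left (hV.norm_adjEquiv_symm_le h w) (norm_nonneg _)
    _ = (coercivityConst K M)⁻¹ * ‖F‖ * ‖w‖ := by ring

/-- The solution operator `F ↦ u`, where `u` represents the functional `F ∘ (T^*)⁻¹`. -/
def solve (hV : IsTransportSpace M K V) {σ : X → ℝ} (h : IsCrossSection μ M σ) :
    StrongDual ℝ (GraphNormed V) →L[ℝ] L2 μ :=
  LinearMap.mkContinuous
    { toFun := fun F => (InnerProductSpace.toDual ℝ (L2 μ)).symm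
        (F.comp ((hV.adjEquiv h).symm : L2 μ →L[ℝ] GraphNormed V))
      map_add' := fun F G => by rw [ContinuousLinearMap.add_comp, map_add]
      map_smul' := fun a F => by
        rw [ContinuousLinearMap.smul_comp, LinearIsometryEquiv.map_smulₛₗ]; rfl }
    (coercivityConst K M)⁻¹ fun F => by
      refine (LinearIsometryEquiv.norm_map (InnerProductSpace.toDual ℝ (L2 μ)).symm _).trans_le ?_
      exact hV.norm_comp_adjEquiv_symm_le h F

theorem inner_solve (hV : IsTransportSpace M K V) {σ : X → ℝ} (h : IsCrossSection μ M σ)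
    (F : StrongDual ℝ (GraphNormed V)) (w : L2 μ) :
    inner ℝ (hV.solve h F) w = F ((hV.adjEquiv h).symm w) :=
  InnerProductSpace.toDual_symm_apply

theorem transportOp_solve (hV : IsTransportSpace M K V) {σ : X → ℝ} (h : IsCrossSection μ M σ)
    (F : StrongDual ℝ (GraphNormed V)) : transportOp h.memLp V (hV.solve h F) = F := by
  ext v
  rw [transportOp_apply, ← inner_adjTransport h.memLp, ← hV.adjEquiv_apply h, inner_solve,
    ContinuousLinearEquiv.symm_apply_apply]

theorem solve_transportOp (hV : IsTransportSpace M K V) {σ : X → ℝ} (h : IsCrossSection μ M σ)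
    (w : L2 μ) : hV.solve h (transportOp h.memLp V w) = w := by
  refine ext_inner_right ℝ fun u => ?_
  rw [inner_solve, transportOp_apply, ← inner_adjTransport h.memLp, ← hV.adjEquiv_apply h,
    ContinuousLinearEquiv.apply_symm_apply]

theorem norm_solve_le (hV : IsTransportSpace M K V) {σ : X → ℝ} (h : IsCrossSection μ M σ) :
    ‖hV.solve h‖ ≤ (coercivityConst K M)⁻¹ :=
  LinearMap.mkContinuous_norm_le _ (inv_nonneg.2 (coercivityConst_pos hV.nonneg M).le) _

/-- The transport operator as an isomorphism of `L₂` onto the dual of the graph space. -/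
def transportEquiv (hV : IsTransportSpace M K V) {σ : X → ℝ} (h : IsCrossSection μ M σ) :
    L2 μ ≃L[ℝ] StrongDual ℝ (GraphNormed V) :=
  ContinuousLinearEquiv.equivOfInverse (transportOp h.memLp V) (hV.solve h)
    (hV.solve_transportOp h) (hV.transportOp_solve h)

theorem norm_transportOp_le (V : Submodule ℝ (Pairs μ)) {σ : X → ℝ}
    (h : IsCrossSection μ M σ) : ‖transportOp h.memLp V‖ ≤ 1 + |M| := by
  refine ContinuousLinearMap.opNorm_le_bound _ (by positivity) fun w => ?_
  refine ContinuousLinearMap.opNorm_le_bound _ (by positivity) fun v => ?_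
  rw [transportOp_apply, ← inner_adjTransport h.memLp]
  refine (abs_real_inner_le_norm _ _).trans ?_
  have h1 := norm_adjTransport_le h v.pair
  rw [← GraphNormed.norm_eq] at h1
  nlinarith [mul_le_mul_of_nonneg_left h1 (norm_nonneg w)]

theorem exists_inverse (hV : IsTransportSpace M K V) {σ : X → ℝ} (h : IsCrossSection μ M σ) :
    ∃ A : L2 μ ≃L[ℝ] StrongDual ℝ (GraphNormed V),
      (∀ w, A w = transportOp h.memLp V w) ∧ ‖transportOp h.memLp V‖ ≤ 1 + |M| ∧
        ‖A.symm.toContinuousLinearMap‖ ≤ (coercivityConst K M)⁻¹ :=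
  ⟨hV.transportEquiv h, fun _ => rfl, norm_transportOp_le V h, hV.norm_solve_le h⟩

theorem transportForm_eq_iff (hV : IsTransportSpace M K V) {σ : X → ℝ}
    (h : IsCrossSection μ M σ) (F : StrongDual ℝ (GraphNormed V)) (u : L2 μ) :
    (∀ v : GraphNormed V, transportForm σ u v.pair = F v) ↔ u = hV.solve h F := by
  constructor
  · intro hu
    rw [← hV.solve_transportOp h u]
    congr 1
    ext v
    rw [transportOp_apply, hu]
  · rintro rfl v
    rw [← transportOp_apply h.memLp, transportOp_solve]

/-- With the norm `‖T^* v‖`, the operator `T^*` is an isometry of `V` onto `L₂`, so that `T` is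
the composition of its transpose with the Riesz isometry. -/
def starEquiv (hV : IsTransportSpace M K V) {σ : X → ℝ} (h : IsCrossSection μ M σ) :
    L2 μ ≃ₗᵢ[ℝ] StrongDual ℝ (StarNormed h.memLp V) where
  toLinearEquiv := LinearEquiv.ofBijective (transportOpStar h.memLp V).toLinearMap (by
    have hs : Function.Surjective (StarNormed.adjL h.memLp V) := hV.adjL_surjective h
    constructor
    · refine (injective_iff_map_eq_zero (transportOpStar h.memLp V)).2 fun w hw => ?_
      obtain ⟨v, hv⟩ := hs w
      have h1 : inner ℝ w (StarNormed.adjL h.memLp V v) = 0 := DFunLike.congr_fun hw v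
      rw [hv] at h1
      exact inner_self_eq_zero.1 h1
    · intro F
      -- `F` factors through `T^*`, since it is bounded by `‖F‖ ‖T^* v‖`
      obtain ⟨B, hB⟩ := hs.hasRightInverse
      have hF : ∀ v w : StarNormed h.memLp V,
          StarNormed.adjL h.memLp V v = StarNormed.adjL h.memLp V w → F v = F w := by
        intro v w hvw
        rw [← sub_eq_zero, ← map_sub, ← norm_le_zero_iff]
        refine (F.le_opNorm _).trans (le_of_eq ?_)
        have : ‖v - w‖ = ‖StarNormed.adjL h.memLp V (v - w)‖ := rfl
        rw [this, map_sub, hvw, sub_self, norm_zero, mul_zero]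
      let G : L2 μ →ₗ[ℝ] ℝ :=
        { toFun := fun w => F (B w)
          map_add' := fun x y => by
            rw [← map_add]; apply hF; rw [map_add, hB, hB, hB]
          map_smul' := fun a x => by
            rw [RingHom.id_apply, ← map_smul]; apply hF; rw [map_smul, hB, hB] }
      have hG : ∀ w, ‖G w‖ ≤ ‖F‖ * ‖w‖ := fun w => by
        refine (F.le_opNorm _).trans (le_of_eq ?_)
        have : ‖B w‖ = ‖StarNormed.adjL h.memLp V (B w)‖ := rfl
        rw [this, hB]
      refine ⟨(InnerProductSpace.toDual ℝ (L2 μ)).symm (G.mkContinuous ‖F‖ hG), ?_⟩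
      ext v
      change inner ℝ _ (StarNormed.adjL h.memLp V v) = F v
      rw [InnerProductSpace.toDual_symm_apply]
      exact hF _ _ (hB _))
  norm_map' w := by
    have hs : Function.Surjective (StarNormed.adjL h.memLp V) := hV.adjL_surjective h
    change ‖transportOpStar h.memLp V w‖ = ‖w‖
    refine le_antisymm ?_ ?_
    · refine ContinuousLinearMap.opNorm_le_bound _ (norm_nonneg _) fun v => ?_
      exact abs_real_inner_le_norm w (StarNormed.adjL h.memLp V v)
    · obtain ⟨v, hv⟩ := hs w
      have h1 := (transportOpStar h.memLp V w).le_opNorm v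
      have h2 : transportOpStar h.memLp V w v = ‖w‖ ^ 2 := by
        change inner ℝ w (StarNormed.adjL h.memLp V v) = _
        rw [hv, real_inner_self_eq_norm_sq]
      have h3 : ‖v‖ = ‖w‖ := by rw [← hv]; rfl
      rw [h2, h3, Real.norm_of_nonneg (by positivity)] at h1
      rcases (norm_nonneg w).eq_or_lt with h0 | h0
      · rw [← h0]; positivity
      · rw [sq] at h1
        exact le_of_mul_le_mul_right h1 h0

theorem exists_isometry [Nontrivial (L2 μ)] (hV : IsTransportSpace M K V) {σ : X → ℝ}
    (h : IsCrossSection μ M σ) :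
    ∃ A : L2 μ ≃ₗᵢ[ℝ] StrongDual ℝ (StarNormed h.memLp V),
      (∀ w, A w = transportOpStar h.memLp V w) ∧ condNumber A.toContinuousLinearEquiv = 1 :=
  ⟨hV.starEquiv h, fun _ => rfl, condNumber_eq_one (hV.starEquiv h)⟩

end IsTransportSpace

/-- A nonzero finite measure has a nonzero square integrable function. -/
theorem nontrivial_L2 [IsFiniteMeasure μ] (h : μ ≠ 0) : Nontrivial (L2 μ) := by
  refine ⟨⟨(memLp_const (1 : ℝ)).toLp, 0, fun h0 => ?_⟩⟩
  have h1 := (MemLp.coeFn_toLp (memLp_const (μ := μ) (p := 2) (1 : ℝ))).symm.trans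
    ((Lp.ext_iff.1 h0).trans (Lp.coeFn_zero ℝ 2 μ))
  refine h (Measure.measure_univ_eq_zero.1 ?_)
  refine measure_mono_null (fun x _ => ?_) (ae_iff.1 h1)
  simp

end AbstractSolvability

/-! ### Normals and exit points of convex sets -/

section Geometry

variable {d : ℕ} {D : Set (E d)} {s : E d}

theorem isOuterNormal_normal {x : E d} (h : HasNormal D x) : IsOuterNormal D x (normal D x) := by
  rw [normal, dif_pos h]
  exact h.choose_spec.1

theorem exists_isOuterNormal (hDne : D.Nonempty) (hDo : IsOpen D) (hDc : Convex ℝ D) {x : E d}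
    (hx : x ∉ D) : ∃ m, IsOuterNormal D x m := by
  obtain ⟨f, hf⟩ := geometric_hahn_banach_open_point hDc hDo hx
  obtain ⟨a, ha⟩ := hDne
  set m := (InnerProductSpace.toDual ℝ (E d)).symm f with hm
  have hfm : ∀ y, inner ℝ m y = f y := fun y => InnerProductSpace.toDual_symm_apply
  have hm0 : m ≠ 0 := by
    rintro h0
    have h1 := hf a ha
    rw [← hfm, ← hfm, h0, inner_zero_left, inner_zero_left] at h1
    exact lt_irrefl _ h1
  refine ⟨‖m‖⁻¹ • m, by
    rw [norm_smul, norm_inv, norm_norm, inv_mul_cancel₀ (norm_ne_zero_iff.2 hm0)], fun y hy => ?_⟩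
  rw [real_inner_smul_left, hfm, map_sub]
  exact mul_nonpos_of_nonneg_of_nonpos (by positivity) (by linarith [hf y hy])

/-- A boundary point touched by a ball inside `D` has only one outward normal, the radial one. -/
theorem hasNormal_of_touching_ball (hDo : IsOpen D) (hDc : Convex ℝ D) {x c : E d} {r : ℝ}
    (hr : 0 < r) (hball : Metric.ball c r ⊆ D) (hxc : ‖x - c‖ = r) (hx : x ∉ D) :
    HasNormal D x := by
  -- equality in Cauchy-Schwarz, after testing with the point `c + r m` of the closed ball
  have huniq : ∀ m, IsOuterNormal D x m → m = r⁻¹ • (x - c) := by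
    intro m hm
    have hcl : ∀ y ∈ Metric.closedBall c r, inner ℝ m (y - x) ≤ 0 := by
      rw [← closure_ball c hr.ne']
      refine fun y hy => closure_minimal (t := {y | inner ℝ m (y - x) ≤ 0})
        (fun y hy => hm.2 y (hball hy)) (isClosed_le (by fun_prop) (by fun_prop)) hy
    have h1 := hcl (c + r • m) (by
      rw [mem_closedBall_iff_norm, add_sub_cancel_left, norm_smul, hm.1, mul_one,
        Real.norm_of_nonneg hr.le])
    have h2 : c + r • m - x = r • m - (x - c) := by abel
    rw [h2, inner_sub_right, real_inner_smul_right, real_inner_self_eq_norm_sq, hm.1] at h1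
    have h3 : inner ℝ m (x - c) = ‖m‖ * ‖x - c‖ := by
      refine le_antisymm (real_inner_le_norm _ _) ?_
      rw [hm.1, hxc]; linarith
    have h4 := inner_eq_norm_mul_iff_real.1 h3
    rw [hxc, hm.1, one_smul] at h4
    rw [← h4, smul_smul, inv_mul_cancel₀ hr.ne', one_smul]
  obtain ⟨m, hm⟩ := exists_isOuterNormal ⟨c, hball (Metric.mem_ball_self hr)⟩ hDo hDc hx
  exact ⟨m, hm, fun m' hm' => (huniq m' hm').trans (huniq m hm).symm⟩

/-- A point where a line in direction `s` leaves `D` is a limit of points of `Γ₊(s)`: near it there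
are boundary points touched by balls inside `D`, and their normals satisfy `s·n > 0`. -/
theorem mem_closure_outflow (hDo : IsOpen D) (hDc : Convex ℝ D) {z : E d} {l : ℝ} (hl : 0 < l)
    (hz : z ∈ D) (hx : z + l • s ∈ frontier D) : z + l • s ∈ closure (outflow D s) := by
  set x₀ := z + l • s with hx₀
  obtain ⟨ρ, hρ, hzρ⟩ := Metric.isOpen_iff.1 hDo z hz
  have hx₀D : x₀ ∈ Dᶜ := by rw [hDo.frontier_eq] at hx; exact hx.2
  refine Metric.mem_closure_iff.2 fun ε hε => ?_
  obtain ⟨c, hcD, hc⟩ := Metric.mem_closure_iff.1 hx.1 (min ε ρ / 2) (by positivity)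
  -- the largest ball in `D` centred at `c` touches the boundary at `x`, near `x₀`
  obtain ⟨x, hxD, hxc⟩ := hDo.isClosed_compl.exists_infDist_eq_dist ⟨x₀, hx₀D⟩ c
  have hr : 0 < dist c x := by
    rw [dist_pos]; rintro rfl; exact hxD hcD
  have hball : Metric.ball c (dist c x) ⊆ D := by
    rw [← hxc]; exact Metric.ball_infDist_compl_subset
  have hle : dist c x ≤ dist c x₀ := hxc ▸ Metric.infDist_le_dist_of_mem hx₀D
  have hxx₀ : dist x₀ x < min ε ρ := by
    rw [dist_comm] at hc
    linarith [dist_triangle x₀ c x, dist_comm x₀ c]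
  have hn : HasNormal D x := hasNormal_of_touching_ball hDo hDc hr hball
    (by rw [dist_comm, dist_eq_norm]) hxD
  refine ⟨x, ⟨⟨?_, ?_⟩, hn, ?_⟩, hxx₀.trans_le (min_le_left _ _)⟩
  · refine closure_mono hball ?_
    rw [closure_ball c hr.ne', Metric.mem_closedBall, dist_comm]
  · rw [hDo.interior_eq]; exact hxD
  · obtain ⟨hm1, hm2⟩ := isOuterNormal_normal hn
    set m := normal D x
    -- `z + ρ' m` lies in `D`, which bounds `m·(x₀ - z) = l (m·s)` away from zero
    obtain ⟨ρ', h1, h2⟩ := exists_between (hxx₀.trans_le (min_le_right _ _))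
    have h0 : 0 ≤ ρ' := dist_nonneg.trans h1.le
    have h3 := hm2 (z + ρ' • m) (hzρ (by
      rwa [mem_ball_iff_norm, add_sub_cancel_left, norm_smul, hm1, mul_one,
        Real.norm_of_nonneg h0]))
    have h4 : z + ρ' • m - x = (x₀ - x) + ρ' • m - l • s := by rw [hx₀]; abel
    rw [h4, inner_sub_right, inner_add_right, real_inner_smul_right, real_inner_smul_right,
      real_inner_self_eq_norm_sq, hm1] at h3
    have h5 := neg_le_of_abs_le (abs_real_inner_le_norm m (x₀ - x))
    rw [hm1, one_mul, ← dist_eq_norm] at h5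
    rw [real_inner_comm]
    have h6 : 0 < l * inner ℝ m s := by linarith
    exact pos_of_mul_pos_right h6 hl.le

/-- The line through a point of `D` stays in `D` until it first meets the boundary. -/
theorem exists_exit (hDo : IsOpen D) (hDb : Bornology.IsBounded D) (hs : ‖s‖ = 1) {x : E d}
    {τ₀ : ℝ} (hx : x + τ₀ • s ∈ D) :
    ∃ β, τ₀ < β ∧ x + β • s ∈ frontier D ∧ ∀ τ ∈ Ico τ₀ β, x + τ • s ∈ D := by
  set T : Set ℝ := {τ | τ₀ ≤ τ ∧ x + τ • s ∉ D} with hT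
  have hcont : Continuous fun τ : ℝ => x + τ • s := by fun_prop
  have hTc : IsClosed T := isClosed_Ici.inter (hDo.preimage hcont).isClosed_compl
  have hTb : BddBelow T := ⟨τ₀, fun τ hτ => hτ.1⟩
  have hTne : T.Nonempty := by
    obtain ⟨r, hr⟩ := hDb.subset_closedBall x
    refine ⟨max τ₀ (|r| + 1), le_max_left _ _, fun h => ?_⟩
    have h1 := hr h
    rw [mem_closedBall_iff_norm, add_sub_cancel_left, norm_smul, hs, mul_one,
      Real.norm_eq_abs] at h1
    linarith [le_abs_self (max τ₀ (|r| + 1)), le_max_right τ₀ (|r| + 1), le_abs_self r]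
  have hβ := hTc.csInf_mem hTne hTb
  have hin : ∀ τ ∈ Ico τ₀ (sInf T), x + τ • s ∈ D := fun τ hτ => by
    by_contra h
    exact absurd (csInf_le hTb ⟨hτ.1, h⟩) (not_le.2 hτ.2)
  have hlt : τ₀ < sInf T := lt_of_le_of_ne hβ.1 fun h => hβ.2 (h ▸ hx)
  refine ⟨sInf T, hlt, ⟨?_, by rw [hDo.interior_eq]; exact hβ.2⟩, hin⟩
  have h1 : sInf T ∈ closure (Ico τ₀ (sInf T)) := by
    rw [closure_Ico hlt.ne]; exact right_mem_Icc.2 hlt.le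
  exact closure_mono (image_subset_iff.2 hin)
    (hcont.continuousAt.continuousWithinAt.mem_closure_image h1)

end Geometry

/-! ### Energy estimates along lines -/

section Lines

variable {d : ℕ} {D : Set (E d)} {s : E d} {φ : E d → ℝ}

/-- `(-2 φ s·∇φ)⁺` on `D`, extended by zero; it dominates the decrease of `φ²` along `s`. -/
noncomputable def energyDensity (D : Set (E d)) (s : E d) (φ : E d → ℝ) : E d → ℝ≥0∞ :=
  D.indicator fun x => ENNReal.ofReal (-(2 * φ x * fderiv ℝ φ x s))

theorem continuousOn_fderiv_apply (hDo : IsOpen D) (h : ContDiffOn ℝ 1 φ (closure D)) :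
    ContinuousOn (fun x => fderiv ℝ φ x s) D :=
  ((h.mono subset_closure).continuousOn_fderiv_of_isOpen hDo le_rfl).clm_apply
    continuousOn_const

theorem measurable_energyDensity (hDo : IsOpen D) (h : ContDiffOn ℝ 1 φ (closure D)) :
    Measurable (energyDensity D s φ) := by
  classical
  have h1 : ContinuousOn (fun x => ENNReal.ofReal (-(2 * φ x * fderiv ℝ φ x s))) D :=
    ENNReal.continuous_ofReal.comp_continuousOn
      (((continuousOn_const.mul (h.continuousOn.mono subset_closure)).mul
        (continuousOn_fderiv_apply hDo h)).neg)
  have h2 := h1.measurable_piecewise (g := 0) continuousOn_const hDo.measurableSet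
  rwa [Set.piecewise_eq_indicator] at h2

/-- A function vanishing on `Γ₊(s)` vanishes by continuity at every point where a line in direction
`s` leaves `D`, although the normal need not be unique there. -/
theorem IsC1Test.eq_zero_of_exit (hφ : IsC1Test D s φ) (hDo : IsOpen D) (hDc : Convex ℝ D)
    {z : E d} {l : ℝ} (hl : 0 < l) (hz : z ∈ D) (hx : z + l • s ∈ frontier D) :
    φ (z + l • s) = 0 := by
  have h1 := mem_closure_outflow hDo hDc hl hz hx
  have hsub : outflow D s ⊆ closure D := fun x hx => hx.1.1
  have h2 : ContinuousWithinAt φ (outflow D s) (z + l • s) :=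
    (hφ.1.continuousOn _ hx.1).mono hsub
  have h3 := h2.mem_closure_image h1
  have h4 : φ '' outflow D s ⊆ {0} := by
    rintro _ ⟨x, hx, rfl⟩; exact hφ.2 x hx
  simpa using closure_mono h4 h3

/-- The value of `φ²` at a point is at most the integral of `(-2 φ s·∇φ)⁺` from there to the point
where the line in direction `s` leaves `D`, since `φ` vanishes at the latter. -/
theorem IsC1Test.sq_le_lintegral_ray (hφ : IsC1Test D s φ) (hDo : IsOpen D) (hDc : Convex ℝ D)
    (hDb : Bornology.IsBounded D) (hs : ‖s‖ = 1) {x : E d} (hx : x ∈ closure D) {τ₀ : ℝ}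
    (hτ₀ : 0 ≤ τ₀) (hz : x + τ₀ • s ∈ D) :
    ENNReal.ofReal (φ x ^ 2)
      ≤ ∫⁻ τ in Ioc 0 (Metric.diam D), energyDensity D s φ (x + τ • s) := by
  obtain ⟨β, hβ, hβf, hβD⟩ := exists_exit hDo hDb hs hz
  have hβ0 : 0 < β := hτ₀.trans_lt hβ
  have hβR : β ≤ Metric.diam D := by
    have h1 := Metric.dist_le_diam_of_mem hDb.closure hβf.1 hx
    rwa [Metric.diam_closure, dist_eq_norm, add_sub_cancel_left, norm_smul, hs, mul_one,
      Real.norm_of_nonneg hβ0.le] at h1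
  -- for `τ < τ₀` the point lies between a point of the closure and an interior point
  have hIoo : ∀ τ ∈ Ioo 0 β, x + τ • s ∈ D := by
    intro τ hτ
    rcases le_or_gt τ₀ τ with h | h
    · exact hβD τ ⟨h, hτ.2⟩
    · have hτ₀' : 0 < τ₀ := hτ.1.trans h
      have h1 := hDc.combo_closure_interior_mem_interior hx (hDo.interior_eq.symm ▸ hz)
        (a := 1 - τ / τ₀) (b := τ / τ₀) (by rw [sub_nonneg, div_le_one hτ₀']; exact h.le)
        (by have := hτ.1; positivity) (by ring)
      have h2 : (1 - τ / τ₀) • x + (τ / τ₀) • (x + τ₀ • s) = x + τ • s := by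
        rw [smul_add, smul_smul, div_mul_cancel₀ _ hτ₀'.ne', ← add_assoc, ← add_smul,
          sub_add_cancel, one_smul]
      rw [h2] at h1
      exact interior_subset h1
  have hIcc : ∀ τ ∈ Icc 0 β, x + τ • s ∈ closure D := by
    have hcont : Continuous fun τ : ℝ => x + τ • s := by fun_prop
    intro τ hτ
    rw [← closure_Ioo hβ0.ne] at hτ
    exact closure_mono (image_subset_iff.2 hIoo)
      (hcont.continuousAt.continuousWithinAt.mem_closure_image hτ)
  have hβ0' : φ (x + β • s) = 0 := by
    have h1 : x + β • s = x + τ₀ • s + (β - τ₀) • s := by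
      rw [add_assoc, ← add_smul, add_sub_cancel]
    rw [h1] at hβf ⊢
    exact hφ.eq_zero_of_exit hDo hDc (sub_pos.2 hβ) hz hβf
  have hcl : ContinuousOn (fun τ : ℝ => x + τ • s) (Icc 0 β) := by fun_prop
  have hφc : ContinuousOn (fun τ : ℝ => φ (x + τ • s)) (Icc 0 β) :=
    hφ.1.continuousOn.comp hcl hIcc
  have huniq : UniqueDiffOn ℝ (closure D) := uniqueDiffOn_convex hDc.closure
    ⟨_, interior_mono subset_closure (hDo.interior_eq.symm ▸ hz)⟩
  have hφ'c : ContinuousOn (fun τ : ℝ => fderivWithin ℝ φ (closure D) (x + τ • s) s)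
      (Icc 0 β) :=
    ((hφ.1.continuousOn_fderivWithin huniq le_rfl).comp hcl hIcc).clm_apply continuousOn_const
  have hfd : ∀ y ∈ D, fderivWithin ℝ φ (closure D) y = fderiv ℝ φ y := fun y hy =>
    fderivWithin_of_mem_nhds (mem_of_superset (hDo.mem_nhds hy) subset_closure)
  have hderiv : ∀ τ ∈ Ioo 0 β, HasDerivAt (fun τ : ℝ => φ (x + τ • s) ^ 2)
      (2 * φ (x + τ • s) * fderivWithin ℝ φ (closure D) (x + τ • s) s) τ := by
    intro τ hτ
    have hD := hIoo τ hτ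
    have h1 : DifferentiableAt ℝ φ (x + τ • s) :=
      (hφ.1.differentiableOn one_ne_zero).differentiableAt
        (mem_of_superset (hDo.mem_nhds hD) subset_closure)
    have h2 : HasDerivAt (fun τ : ℝ => x + τ • s) s τ := by
      simpa using ((hasDerivAt_id τ).smul_const s).const_add x
    have h3 := (h1.hasFDerivAt.comp_hasDerivAt τ h2).pow 2
    rw [hfd _ hD]
    exact HasDerivAt.congr_deriv (f := fun τ : ℝ => φ (x + τ • s) ^ 2) h3 (by simp)
  have hint : ContinuousOn (fun τ : ℝ =>
      2 * φ (x + τ • s) * fderivWithin ℝ φ (closure D) (x + τ • s) s) (Icc 0 β) :=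
    (continuousOn_const.mul hφc).mul hφ'c
  have hii : IntervalIntegrable (fun τ : ℝ =>
      2 * φ (x + τ • s) * fderivWithin ℝ φ (closure D) (x + τ • s) s) volume 0 β :=
    hint.intervalIntegrable_of_Icc hβ0.le
  have hftc := intervalIntegral.integral_eq_sub_of_hasDerivAt_of_le hβ0.le (hφc.pow 2) hderiv hii
  simp only [Pi.pow_apply, hβ0', zero_smul, add_zero] at hftc
  have hsq : φ x ^ 2 = ∫ τ in Ioo 0 β,
      -(2 * φ (x + τ • s) * fderivWithin ℝ φ (closure D) (x + τ • s) s) := by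
    rw [← integral_Ioc_eq_integral_Ioo, integral_neg,
      ← intervalIntegral.integral_of_le hβ0.le, hftc]
    ring
  have hion : Integrable (fun τ : ℝ =>
      -(2 * φ (x + τ • s) * fderivWithin ℝ φ (closure D) (x + τ • s) s))
      (volume.restrict (Ioo 0 β)) :=
    (((intervalIntegrable_iff_integrableOn_Ioo_of_le hβ0.le).1 hii)).neg
  calc ENNReal.ofReal (φ x ^ 2)
      ≤ ENNReal.ofReal (∫ τ in Ioo 0 β, max
          (-(2 * φ (x + τ • s) * fderivWithin ℝ φ (closure D) (x + τ • s) s)) 0) := by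
        rw [hsq]
        exact ENNReal.ofReal_le_ofReal
          (integral_mono hion hion.pos_part fun τ => le_max_left _ _)
    _ = ∫⁻ τ in Ioo 0 β, ENNReal.ofReal (max
          (-(2 * φ (x + τ • s) * fderivWithin ℝ φ (closure D) (x + τ • s) s)) 0) :=
        ofReal_integral_eq_lintegral_ofReal hion.pos_part
          (Eventually.of_forall fun τ => le_max_right _ _)
    _ = ∫⁻ τ in Ioo 0 β, energyDensity D s φ (x + τ • s) := by
        refine setLIntegral_congr_fun measurableSet_Ioo fun τ hτ => ?_
        have hD := hIoo τ hτ
        simp only [energyDensity, indicator_of_mem hD, hfd _ hD]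
        rw [ENNReal.ofReal_max, ENNReal.ofReal_zero]
        exact max_eq_left zero_le
    _ ≤ ∫⁻ τ in Ioc 0 (Metric.diam D), energyDensity D s φ (x + τ • s) :=
        lintegral_mono_set fun τ hτ => ⟨hτ.1, hτ.2.le.trans hβR⟩

theorem lintegral_energyDensity (hDo : IsOpen D) :
    ∫⁻ x, energyDensity D s φ x
      = ∫⁻ x in D, ENNReal.ofReal (-(2 * φ x * fderiv ℝ φ x s)) :=
  lintegral_indicator hDo.measurableSet _

/-- The ray estimate integrated over `D`; each shift of the energy density has the same integral,
and the rays have length at most `diam D`. -/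
theorem IsC1Test.lintegral_sq_le (hφ : IsC1Test D s φ) (hDo : IsOpen D) (hDc : Convex ℝ D)
    (hDb : Bornology.IsBounded D) (hs : ‖s‖ = 1) :
    ∫⁻ x in D, ENNReal.ofReal (φ x ^ 2)
      ≤ ENNReal.ofReal (Metric.diam D) * ∫⁻ x, energyDensity D s φ x := by
  have hm := measurable_energyDensity (s := s) hDo hφ.1
  calc ∫⁻ x in D, ENNReal.ofReal (φ x ^ 2)
      ≤ ∫⁻ x in D, ∫⁻ τ in Ioc 0 (Metric.diam D), energyDensity D s φ (x + τ • s) :=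
        setLIntegral_mono' hDo.measurableSet fun x hx =>
          hφ.sq_le_lintegral_ray hDo hDc hDb hs (subset_closure hx) le_rfl
            (by simpa using hx)
    _ ≤ ∫⁻ x, ∫⁻ τ in Ioc 0 (Metric.diam D), energyDensity D s φ (x + τ • s) :=
        setLIntegral_le_lintegral _ _
    _ = ∫⁻ τ in Ioc 0 (Metric.diam D), ∫⁻ x, energyDensity D s φ (x + τ • s) :=
        lintegral_lintegral_swap (hm.comp (by fun_prop)).aemeasurable
    _ = ∫⁻ τ in Ioc 0 (Metric.diam D), ∫⁻ x, energyDensity D s φ x := by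
        refine lintegral_congr fun τ => lintegral_add_right_eq_self _ _
    _ = _ := by rw [setLIntegral_const, Real.volume_Ioc, sub_zero, mul_comm]

/-- On `D` the pointwise derivative in a representing pair is that of the Fréchet derivative. -/
theorem snd_ae_eq_fderiv (hDo : IsOpen D) (hφ : ContDiffOn ℝ 1 φ (closure D)) {g : E d → ℝ}
    (hg : ∀ᵐ x ∂domMeasure D, HasLineDerivAt ℝ φ (g x) x s) :
    g =ᵐ[domMeasure D] fun x => fderiv ℝ φ x s := by
  filter_upwards [hg, ae_restrict_mem hDo.measurableSet] with x h2 h4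
  have h5 : DifferentiableAt ℝ φ x := (hφ.differentiableOn one_ne_zero).differentiableAt
    (mem_of_superset (hDo.mem_nhds h4) subset_closure)
  exact h2.unique (h5.hasFDerivAt.hasLineDerivAt s)

/-- The Poincaré inequality before Cauchy-Schwarz; the sign of `σ` is used here. -/
theorem IsC1Test.lintegral_sq_le_of_ae (hφ : IsC1Test D s φ) (hDo : IsOpen D) (hDc : Convex ℝ D)
    (hDb : Bornology.IsBounded D) (hs : ‖s‖ = 1) {v g σ : E d → ℝ}
    (hv : v =ᵐ[domMeasure D] φ) (hg : ∀ᵐ x ∂domMeasure D, HasLineDerivAt ℝ φ (g x) x s)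
    (hσ : ∀ᵐ x ∂domMeasure D, 0 ≤ σ x) :
    ∫⁻ x in D, ENNReal.ofReal (v x ^ 2)
      ≤ ENNReal.ofReal (Metric.diam D)
        * ∫⁻ x in D, ENNReal.ofReal (2 * v x * (σ x * v x - g x)) := by
  have h1 : ∫⁻ x in D, ENNReal.ofReal (v x ^ 2) = ∫⁻ x in D, ENNReal.ofReal (φ x ^ 2) :=
    lintegral_congr_ae (hv.mono fun x hx => by simp only [hx])
  rw [h1]
  refine (hφ.lintegral_sq_le hDo hDc hDb hs).trans (mul_le_mul_right ?_ _)
  rw [lintegral_energyDensity hDo]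
  refine lintegral_mono_ae ?_
  filter_upwards [hv, snd_ae_eq_fderiv hDo hφ.1 hg, hσ] with x h1 h2 h3
  rw [h1, h2]
  refine ENNReal.ofReal_le_ofReal ?_
  nlinarith [mul_nonneg h3 (mul_self_nonneg (φ x))]

end Lines

/-! ### Square integrable functions -/

section CauchySchwarz

variable {X : Type*} [MeasurableSpace X] {μ : Measure X}

theorem norm_sq_eq_integral (v : L2 μ) : ‖v‖ ^ 2 = ∫ x, v x ^ 2 ∂μ := by
  rw [← real_inner_self_eq_norm_sq, L2.inner_def]
  simp [sq]

theorem lintegral_ofReal_sq (v : L2 μ) :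
    ∫⁻ x, ENNReal.ofReal (v x ^ 2) ∂μ = ENNReal.ofReal (‖v‖ ^ 2) := by
  rw [norm_sq_eq_integral, ofReal_integral_eq_lintegral_ofReal (Lp.memLp v).integrable_sq
    (Eventually.of_forall fun x => sq_nonneg _)]

theorem integral_abs_mul_le (v g : L2 μ) : ∫ x, |v x * g x| ∂μ ≤ ‖v‖ * ‖g‖ := by
  have h1 : ∫ x, |v x * g x| ∂μ = inner ℝ |v| |g| := by
    rw [L2.inner_def]
    refine integral_congr_ae ?_
    filter_upwards [Lp.coeFn_abs v, Lp.coeFn_abs g] with x h1 h2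
    rw [h1, h2, abs_mul]
    simp [mul_comm]
  rw [h1, ← norm_abs_eq_norm v, ← norm_abs_eq_norm g]
  exact real_inner_le_norm _ _

/-- Cauchy-Schwarz turns the integrated energy estimate into a bound for the norms. -/
theorem norm_le_of_lintegral_sq_le {R : ℝ} (hR : 0 ≤ R) {v g : L2 μ}
    (h : ∫⁻ x, ENNReal.ofReal (v x ^ 2) ∂μ
      ≤ ENNReal.ofReal R * ∫⁻ x, ENNReal.ofReal (2 * v x * g x) ∂μ) :
    ‖v‖ ≤ 2 * R * ‖g‖ := by
  have hi : Integrable (fun x => |v x * g x|) μ :=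
    ((Lp.memLp v).integrable_mul (Lp.memLp g)).abs
  have h1 : ∫⁻ x, ENNReal.ofReal (2 * v x * g x) ∂μ ≤ ENNReal.ofReal (2 * (‖v‖ * ‖g‖)) := by
    calc ∫⁻ x, ENNReal.ofReal (2 * v x * g x) ∂μ
        ≤ ∫⁻ x, ENNReal.ofReal (2 * |v x * g x|) ∂μ := by
          refine lintegral_mono fun x => ENNReal.ofReal_le_ofReal ?_
          rw [mul_assoc]
          exact mul_le_mul_of_nonneg_left (le_abs_self _) zero_le_two
      _ = ENNReal.ofReal (∫ x, 2 * |v x * g x| ∂μ) :=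
          (ofReal_integral_eq_lintegral_ofReal (hi.const_mul 2)
            (Eventually.of_forall fun x => by positivity)).symm
      _ ≤ _ := by
          rw [integral_const_mul]
          exact ENNReal.ofReal_le_ofReal
            (mul_le_mul_of_nonneg_left (integral_abs_mul_le v g) zero_le_two)
  have h2 := h.trans (mul_le_mul_right h1 _)
  rw [lintegral_ofReal_sq, ← ENNReal.ofReal_mul hR,
    ENNReal.ofReal_le_ofReal_iff (by positivity)] at h2
  rcases (norm_nonneg v).eq_or_lt with h0 | h0
  · rw [← h0]; positivity
  · refine le_of_mul_le_mul_right ?_ h0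
    nlinarith

end CauchySchwarz

/-! ### The trace on the inflow boundary -/

noncomputable section Trace

variable {d : ℕ} {D : Set (E d)} {s : E d} {φ : E d → ℝ}

/-- Integration over `ℝᵈ` along the lines in direction `s`. -/
theorem measurePreserving_line (hs : ‖s‖ = 1) :
    MeasurePreserving (fun q : Hyperplane s × ℝ => (q.1 : E d) + q.2 • s)
      (volume.prod volume) volume := by
  have h1 := (LinearIsometryEquiv.measurePreserving
    (LinearIsometryEquiv.toSpanUnitSingleton (𝕜 := ℝ) s hs)).prod
      (MeasurePreserving.id (volume : Measure (Hyperplane s)))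
  have h2 := ((ℝ ∙ s).orthogonalDecomposition.symm.measurePreserving.comp
    (WithLp.volume_preserving_toLp (ℝ ∙ s) (ℝ ∙ s)ᗮ)).comp
      (h1.comp Measure.measurePreserving_swap)
  refine (congrArg (fun f => MeasurePreserving f (volume.prod volume) volume) ?_).mp h2
  funext q
  have h3 := DFunLike.congr_fun (Submodule.coe_orthogonalDecomposition_symm (𝕜 := ℝ) (ℝ ∙ s))
    (WithLp.toLp 2 (LinearIsometryEquiv.toSpanUnitSingleton (𝕜 := ℝ) s hs q.2, q.1))
  refine Eq.trans h3 ?_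
  simp [add_comm]

theorem isOpen_shadow (hDo : IsOpen D) : IsOpen (shadow D s) := by
  have h1 : shadow D s = ⋃ t : ℝ, (fun y : Hyperplane s => (y : E d) + t • s) ⁻¹' D := by
    ext y; simp [shadow]
  rw [h1]
  exact isOpen_iUnion fun t => hDo.preimage (by fun_prop)

theorem bddBelow_line (hDb : Bornology.IsBounded D) (hs : ‖s‖ = 1) (y : Hyperplane s) :
    BddBelow {t : ℝ | (y : E d) + t • s ∈ D} := by
  obtain ⟨r, hr⟩ := hDb.subset_closedBall (y : E d)
  refine ⟨-r, fun t ht => ?_⟩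
  have h1 := hr ht
  rw [mem_closedBall_iff_norm, add_sub_cancel_left, norm_smul, hs, mul_one,
    Real.norm_eq_abs] at h1
  exact (abs_le.1 h1).1

theorem measurable_entryTime (hDo : IsOpen D) (hDb : Bornology.IsBounded D) (hs : ‖s‖ = 1) :
    Measurable (entryTime D s) := by
  refine measurable_of_Iio fun a => ?_
  -- off the shadow, `entryTime` is `sInf ∅ = 0`
  have h1 : entryTime D s ⁻¹' Iio a
      = (⋃ t : Iio a, (fun y : Hyperplane s => (y : E d) + (t : ℝ) • s) ⁻¹' D)
        ∪ ((shadow D s)ᶜ ∩ {_y | 0 < a}) := by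
    ext y
    by_cases hy : y ∈ shadow D s
    · have h2 : entryTime D s y < a ↔ ∃ t ∈ {t : ℝ | (y : E d) + t • s ∈ D}, t < a :=
        csInf_lt_iff (bddBelow_line hDb hs y) hy
      simp only [mem_preimage, mem_Iio, h2, mem_union, mem_iUnion, mem_inter_iff, mem_compl_iff,
        hy, not_true_eq_false, false_and, or_false]
      constructor
      · rintro ⟨t, ht, hta⟩; exact ⟨⟨t, hta⟩, ht⟩
      · rintro ⟨⟨t, hta⟩, ht⟩; exact ⟨t, ht, hta⟩
    · have h3 : ∀ t : ℝ, (y : E d) + t • s ∉ D := fun t ht => hy ⟨t, ht⟩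
      simp [entryTime, hy, h3]
  rw [h1]
  refine (isOpen_iUnion fun t => hDo.preimage (by fun_prop)).measurableSet.union
    ((isOpen_shadow hDo).measurableSet.compl.inter (MeasurableSet.const _))

theorem measurable_entryPoint (hDo : IsOpen D) (hDb : Bornology.IsBounded D) (hs : ‖s‖ = 1) :
    Measurable (entryPoint D s) :=
  measurable_subtype_coe.add ((measurable_entryTime hDo hDb hs).smul_const s)

theorem entryPoint_mem_closure (hDb : Bornology.IsBounded D) (hs : ‖s‖ = 1) {y : Hyperplane s}
    (hy : y ∈ shadow D s) : entryPoint D s y ∈ closure D := by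
  have h1 : entryTime D s y ∈ closure {t : ℝ | (y : E d) + t • s ∈ D} :=
    csInf_mem_closure hy (bddBelow_line hDb hs y)
  have hcont : Continuous fun t : ℝ => (y : E d) + t • s := by fun_prop
  exact closure_mono (image_subset_iff.2 fun t ht => ht)
    (hcont.continuousAt.continuousWithinAt.mem_closure_image h1)

theorem abs_mul_norm_le {H : Type*} [NormedAddCommGroup H] [NormedSpace ℝ H] (L : H →L[ℝ] ℝ)
    {c b : ℝ} (hb : 0 ≤ b) (h : ∀ u, |c * L u| ≤ b * ‖u‖) : |c| * ‖L‖ ≤ b := by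
  rw [← Real.norm_eq_abs, ← norm_smul]
  exact ContinuousLinearMap.opNorm_le_bound _ hb h

theorem norm_fderiv_eq_zero {H : Type*} [NormedAddCommGroup H] [NormedSpace ℝ H] {f : H → ℝ}
    {y : H} (h : ¬DifferentiableAt ℝ f y) : ‖fderiv ℝ f y‖ = 0 := by
  rw [fderiv_zero_of_not_differentiableAt h, norm_zero]

/-- The normal is a subgradient of the entry time, so `∇α = n' / |n·s|` with the component `n'` of
`n` orthogonal to `s`, and the density `|n·s| √(1 + |∇α|²)` is `1` where `α` is differentiable;
elsewhere `fderiv` vanishes and the density is `|n·s| ≤ 1`, which is `0` if the normal is not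
defined. -/
theorem inflow_density_le_one (hDo : IsOpen D) (hDb : Bornology.IsBounded D) (hs : ‖s‖ = 1)
    {y : Hyperplane s} (hy : y ∈ shadow D s) :
    |inner ℝ s (normal D (entryPoint D s y))| * √(1 + ‖fderiv ℝ (entryTime D s) y‖ ^ 2) ≤ 1 := by
  by_cases hn : HasNormal D (entryPoint D s y)
  swap
  · rw [normal, dif_neg hn, inner_zero_right, abs_zero, zero_mul]
    exact zero_le_one
  obtain ⟨hm1, hm2⟩ := isOuterNormal_normal hn
  set m := normal D (entryPoint D s y)
  have habs : |inner ℝ s m| ≤ 1 := by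
    simpa [hs, hm1] using abs_real_inner_le_norm s m
  by_cases hdiff : DifferentiableAt ℝ (entryTime D s) y
  swap
  · have h0 : ‖fderiv ℝ (entryTime D s) y‖ = 0 := norm_fderiv_eq_zero hdiff
    rw [h0]
    simpa using habs
  have hm3 : ∀ z ∈ closure D, inner ℝ m (z - entryPoint D s y) ≤ 0 := fun z hz =>
    closure_minimal (t := {z | inner ℝ m (z - entryPoint D s y) ≤ 0}) (fun z hz => hm2 z hz)
      (isClosed_le (by fun_prop) (by fun_prop)) hz
  have hsub : ∀ y' ∈ shadow D s, inner ℝ m ((y' : E d) - y)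
      + (entryTime D s y' - entryTime D s y) * inner ℝ s m ≤ 0 := by
    intro y' hy'
    have h1 := hm3 _ (entryPoint_mem_closure hDb hs hy')
    have h2 : entryPoint D s y' - entryPoint D s y
        = ((y' : E d) - y) + (entryTime D s y' - entryTime D s y) • s := by
      rw [entryPoint, entryPoint, sub_smul]; abel
    rwa [h2, inner_add_right, real_inner_smul_right, real_inner_comm s m] at h1
  have hderiv : ∀ u : Hyperplane s,
      inner ℝ m (u : E d) + fderiv ℝ (entryTime D s) y u * inner ℝ s m = 0 := by
    -- the supporting hyperplane at the entry point touches the graph of the entry time at `y`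
    have hmax : IsLocalMax (fun y' : Hyperplane s =>
        innerSL ℝ m (y' : E d) + entryTime D s y' * inner ℝ s m) y := by
      filter_upwards [(isOpen_shadow hDo).mem_nhds hy] with y' hy'
      have h1 := hsub y' hy'
      rw [inner_sub_right] at h1
      simp only [innerSL_apply_apply]
      linarith
    have h1 : HasFDerivAt (fun y' : Hyperplane s =>
        innerSL ℝ m (y' : E d) + entryTime D s y' * inner ℝ s m)
        ((innerSL ℝ m).comp (Hyperplane s).subtypeL
          + (inner ℝ s m : ℝ) • fderiv ℝ (entryTime D s) y) y :=
      (((innerSL ℝ m).comp (Hyperplane s).subtypeL).hasFDerivAt).add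
        (hdiff.hasFDerivAt.mul_const _)
    have h2 := hmax.hasFDerivAt_eq_zero h1
    intro u
    have h3 := DFunLike.congr_fun h2 u
    simpa [mul_comm] using h3
  set c := inner ℝ s m with hc
  have hproj : ‖m - c • s‖ ^ 2 = 1 - c ^ 2 := by
    rw [norm_sub_sq_real, real_inner_smul_right, real_inner_comm, ← hc, norm_smul, hs, hm1,
      Real.norm_eq_abs, mul_one, sq_abs]
    ring
  have hnorm : |c| * ‖fderiv ℝ (entryTime D s) y‖ ≤ ‖m - c • s‖ := by
    refine abs_mul_norm_le _ (norm_nonneg _) fun u => ?_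
    have h1 : inner ℝ s (u : E d) = 0 :=
      (Submodule.mem_orthogonal_singleton_iff_inner_right).1 u.2
    have h2 : c * fderiv ℝ (entryTime D s) y u = -inner ℝ (m - c • s) (u : E d) := by
      rw [inner_sub_left, real_inner_smul_left, h1, mul_zero, sub_zero]
      have := hderiv u
      linarith
    rw [h2, abs_neg]
    exact abs_real_inner_le_norm _ _
  have h1 : (|c| * ‖fderiv ℝ (entryTime D s) y‖) ^ 2 ≤ 1 - c ^ 2 := by
    rw [← hproj]
    exact pow_le_pow_left₀ (by positivity) hnorm 2
  refine abs_le_of_sq_le_sq' (b := 1) ?_ zero_le_one |>.2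
  rw [mul_pow, Real.sq_sqrt (by positivity), sq_abs]
  rw [mul_pow, sq_abs] at h1
  linarith

theorem inflowMeasure_le (hDo : IsOpen D) (hDb : Bornology.IsBounded D) (hs : ‖s‖ = 1) :
    inflowMeasure D s ≤ (volume.restrict (shadow D s)).map (entryPoint D s) := by
  refine Measure.map_mono ?_ (measurable_entryPoint hDo hDb hs)
  -- the restricting set need not be known to be measurable, but the shadow is open
  have hle : volume.restrict {y | y ∈ shadow D s ∧ entryPoint D s y ∈ inflow D s}
      ≤ volume.restrict (shadow D s) := Measure.restrict_mono_set _ fun y hy => hy.1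
  refine le_trans ?_ hle
  conv_rhs => rw [← withDensity_one (μ := volume.restrict _)]
  refine withDensity_mono (ae_mono hle ?_)
  filter_upwards [ae_restrict_mem (isOpen_shadow hDo).measurableSet] with y hy
  exact ENNReal.ofReal_le_one.2 (inflow_density_le_one hDo hDb hs hy)

theorem ae_inflowMeasure_mem_closure (hDo : IsOpen D) (hDb : Bornology.IsBounded D)
    (hs : ‖s‖ = 1) : ∀ᵐ x ∂inflowMeasure D s, x ∈ closure D := by
  refine ae_mono (inflowMeasure_le hDo hDb hs) ?_
  refine (ae_map_iff (p := fun x => x ∈ closure D)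
    (measurable_entryPoint hDo hDb hs).aemeasurable isClosed_closure.measurableSet).2 ?_
  filter_upwards [ae_restrict_mem (isOpen_shadow hDo).measurableSet] with y hy
  exact entryPoint_mem_closure hDb hs hy

/-- The ray estimate from the entry points, integrated over the shadow of `D`. -/
theorem IsC1Test.lintegral_inflow_sq_le (hφ : IsC1Test D s φ) (hDo : IsOpen D)
    (hDc : Convex ℝ D) (hDb : Bornology.IsBounded D) (hs : ‖s‖ = 1) :
    ∫⁻ x, ENNReal.ofReal (φ x ^ 2) ∂inflowMeasure D s ≤ ∫⁻ x, energyDensity D s φ x := by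
  have hm := measurable_energyDensity (s := s) hDo hφ.1
  calc ∫⁻ x, ENNReal.ofReal (φ x ^ 2) ∂inflowMeasure D s
      ≤ ∫⁻ x, ENNReal.ofReal (φ x ^ 2) ∂(volume.restrict (shadow D s)).map (entryPoint D s) :=
        lintegral_mono' (inflowMeasure_le hDo hDb hs) le_rfl
    _ ≤ ∫⁻ y in shadow D s, ENNReal.ofReal (φ (entryPoint D s y) ^ 2) := lintegral_map_le _ _
    _ ≤ ∫⁻ y in shadow D s, ∫⁻ t, energyDensity D s φ ((y : E d) + t • s) := by
        refine setLIntegral_mono' (isOpen_shadow hDo).measurableSet fun y hy => ?_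
        obtain ⟨t, ht⟩ := hy
        have h1 : entryTime D s y ≤ t := csInf_le (bddBelow_line hDb hs y) ht
        refine (hφ.sq_le_lintegral_ray hDo hDc hDb hs (entryPoint_mem_closure hDb hs ⟨t, ht⟩)
          (sub_nonneg.2 h1) ?_).trans ((setLIntegral_le_lintegral _ _).trans (le_of_eq ?_))
        · rwa [entryPoint, add_assoc, ← add_smul, add_sub_cancel]
        · simp_rw [entryPoint, add_assoc, ← add_smul]
          exact lintegral_add_left_eq_self
            (fun t : ℝ => energyDensity D s φ ((y : E d) + t • s)) _
    _ ≤ ∫⁻ y : Hyperplane s, ∫⁻ t : ℝ, energyDensity D s φ ((y : E d) + t • s) :=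
        setLIntegral_le_lintegral _ _
    _ = ∫⁻ q : Hyperplane s × ℝ, energyDensity D s φ ((q.1 : E d) + q.2 • s)
          ∂(volume.prod volume) :=
        (lintegral_prod _ (hm.comp (measurePreserving_line hs).measurable).aemeasurable).symm
    _ = _ := (measurePreserving_line hs).lintegral_comp hm

theorem IsC1Test.lintegral_inflow_sq_le_norm (hφ : IsC1Test D s φ) (hDo : IsOpen D)
    (hDc : Convex ℝ D) (hDb : Bornology.IsBounded D) (hs : ‖s‖ = 1)
    {p : Pairs (domMeasure D)} (hp : Represents D s φ p) :
    ∫⁻ x, ENNReal.ofReal (φ x ^ 2) ∂inflowMeasure D s ≤ ENNReal.ofReal (‖p‖ ^ 2) := by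
  refine (hφ.lintegral_inflow_sq_le hDo hDc hDb hs).trans ?_
  rw [lintegral_energyDensity hDo, p.norm_sq, ENNReal.ofReal_add (by positivity) (by positivity),
    ← lintegral_ofReal_sq, ← lintegral_ofReal_sq, ← lintegral_add_left' (by
      exact ((Lp.aestronglyMeasurable p.fst).aemeasurable.pow_const 2).ennreal_ofReal)]
  refine lintegral_mono_ae ?_
  filter_upwards [hp.1, snd_ae_eq_fderiv hDo hφ.1 hp.2] with x h1 h2
  rw [h1, h2, ← ENNReal.ofReal_add (by positivity) (by positivity)]
  exact ENNReal.ofReal_le_ofReal (by nlinarith [sq_nonneg (φ x + fderiv ℝ φ x s)])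

theorem IsC1Test.memLp_inflow (hφ : IsC1Test D s φ) (hDo : IsOpen D)
    (hDc : Convex ℝ D) (hDb : Bornology.IsBounded D) (hs : ‖s‖ = 1)
    {p : Pairs (domMeasure D)} (hp : Represents D s φ p) : MemLp φ 2 (inflowMeasure D s) := by
  have h1 : AEStronglyMeasurable φ (inflowMeasure D s) := by
    rw [← Measure.restrict_eq_self_of_ae_mem (ae_inflowMeasure_mem_closure hDo hDb hs)]
    exact hφ.1.continuousOn.aestronglyMeasurable isClosed_closure.measurableSet
  rw [memLp_two_iff_integrable_sq h1]
  refine ⟨h1.pow 2, ?_⟩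
  rw [hasFiniteIntegral_iff_ofReal (Eventually.of_forall fun x => sq_nonneg _)]
  exact (hφ.lintegral_inflow_sq_le_norm hDo hDc hDb hs hp).trans_lt ENNReal.ofReal_lt_top

theorem Represents.eqOn_closure (hDo : IsOpen D) {ψ : E d → ℝ} {p : Pairs (domMeasure D)}
    (hφ : ContDiffOn ℝ 1 φ (closure D)) (hψ : ContDiffOn ℝ 1 ψ (closure D))
    (h1 : Represents D s φ p) (h2 : Represents D s ψ p) : EqOn φ ψ (closure D) := by
  have h3 : EqOn φ ψ D := Measure.eqOn_open_of_ae_eq (h1.1.symm.trans h2.1) hDo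
    (hφ.continuousOn.mono subset_closure) (hψ.continuousOn.mono subset_closure)
  exact h3.of_subset_closure hφ.continuousOn hψ.continuousOn subset_closure subset_rfl

theorem IsC1Test.add {ψ : E d → ℝ} (hφ : IsC1Test D s φ) (hψ : IsC1Test D s ψ) :
    IsC1Test D s (φ + ψ) :=
  ⟨hφ.1.add hψ.1, fun x hx => by simp [hφ.2 x hx, hψ.2 x hx]⟩

theorem IsC1Test.const_smul (hφ : IsC1Test D s φ) (c : ℝ) : IsC1Test D s (c • φ) :=
  ⟨hφ.1.const_smul c, fun x hx => by simp [hφ.2 x hx]⟩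

theorem Represents.add {ψ : E d → ℝ} {p q : Pairs (domMeasure D)} (hp : Represents D s φ p)
    (hq : Represents D s ψ q) : Represents D s (φ + ψ) (p + q) := by
  refine ⟨?_, ?_⟩
  · rw [Pairs.add_fst]
    exact (Lp.coeFn_add _ _).trans (hp.1.add hq.1)
  · rw [Pairs.add_snd]
    filter_upwards [Lp.coeFn_add p.snd q.snd, hp.2, hq.2] with x h1 h2 h3
    rw [h1]
    exact hasLineDerivAt_add h2 h3

theorem Represents.const_smul {p : Pairs (domMeasure D)} (hp : Represents D s φ p) (c : ℝ) :
    Represents D s (c • φ) (c • p) := by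
  refine ⟨?_, ?_⟩
  · rw [Pairs.smul_fst]
    exact (Lp.coeFn_smul _ _).trans (hp.1.const_smul c)
  · rw [Pairs.smul_snd]
    filter_upwards [Lp.coeFn_smul c p.snd, hp.2] with x h1 h2
    rw [h1]
    exact hasLineDerivAt_const_smul c h2

theorem ae_eq_of_represents (hDo : IsOpen D) (hDb : Bornology.IsBounded D) (hs : ‖s‖ = 1)
    {ψ : E d → ℝ} {p : Pairs (domMeasure D)} (hφ : IsC1Test D s φ) (hψ : IsC1Test D s ψ)
    (h1 : Represents D s φ p) (h2 : Represents D s ψ p) : φ =ᵐ[inflowMeasure D s] ψ := by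
  filter_upwards [ae_inflowMeasure_mem_closure hDo hDb hs] with x hx
  exact h1.eqOn_closure hDo hφ.1 hψ.1 h2 hx

/-- The trace on `Γ₋(s)` of the pairs represented by functions in `C¹(closure D)` vanishing on
`Γ₊(s)`: the restriction of such a function, which does not depend on its choice. -/
def c1Trace (hDo : IsOpen D) (hDc : Convex ℝ D) (hDb : Bornology.IsBounded D) (hs : ‖s‖ = 1) :
    c1Space D s →ₗ[ℝ] L2 (inflowMeasure D s) where
  toFun p := (p.2.2.choose_spec.1.memLp_inflow hDo hDc hDb hs p.2.2.choose_spec.2).toLp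
  map_add' p q := by
    refine Lp.ext ((MemLp.coeFn_toLp _).trans ?_)
    refine EventuallyEq.trans ?_ (Lp.coeFn_add _ _).symm
    refine EventuallyEq.trans ?_
      ((MemLp.coeFn_toLp _).symm.add (MemLp.coeFn_toLp _).symm)
    exact ae_eq_of_represents hDo hDb hs (p + q).2.2.choose_spec.1
      (p.2.2.choose_spec.1.add q.2.2.choose_spec.1) (p + q).2.2.choose_spec.2
      (p.2.2.choose_spec.2.add q.2.2.choose_spec.2)
  map_smul' c p := by
    refine Lp.ext ((MemLp.coeFn_toLp _).trans ?_)
    refine EventuallyEq.trans ?_ (Lp.coeFn_smul _ _).symm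
    refine EventuallyEq.trans ?_ ((MemLp.coeFn_toLp _).symm.const_smul c)
    exact ae_eq_of_represents hDo hDb hs (c • p).2.2.choose_spec.1
      (p.2.2.choose_spec.1.const_smul c) (c • p).2.2.choose_spec.2
      (p.2.2.choose_spec.2.const_smul c)

theorem c1Trace_ae_eq (hDo : IsOpen D) (hDc : Convex ℝ D) (hDb : Bornology.IsBounded D)
    (hs : ‖s‖ = 1) (p : c1Space D s) (hφ : IsC1Test D s φ)
    (hp : Represents D s φ (p : Pairs (domMeasure D))) :
    c1Trace hDo hDc hDb hs p =ᵐ[inflowMeasure D s] φ :=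
  (MemLp.coeFn_toLp (p.2.2.choose_spec.1.memLp_inflow hDo hDc hDb hs
    p.2.2.choose_spec.2)).trans (ae_eq_of_represents hDo hDb hs p.2.2.choose_spec.1 hφ
    p.2.2.choose_spec.2 hp)

theorem norm_c1Trace_le (hDo : IsOpen D) (hDc : Convex ℝ D) (hDb : Bornology.IsBounded D)
    (hs : ‖s‖ = 1) (p : c1Space D s) :
    ‖c1Trace hDo hDc hDb hs p‖ ≤ ‖(p : Pairs (domMeasure D))‖ := by
  obtain ⟨φ, hφ, hp⟩ := p.2.2
  have h1 := hφ.lintegral_inflow_sq_le_norm hDo hDc hDb hs hp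
  rw [← lintegral_congr_ae ((c1Trace_ae_eq hDo hDc hDb hs p hφ hp).mono fun x hx => by
    simp only [hx] : (fun x => ENNReal.ofReal (c1Trace hDo hDc hDb hs p x ^ 2))
      =ᵐ[inflowMeasure D s] fun x => ENNReal.ofReal (φ x ^ 2)), lintegral_ofReal_sq,
    ENNReal.ofReal_le_ofReal_iff (by positivity)] at h1
  exact abs_le_of_sq_le_sq' h1 (norm_nonneg _) |>.2

/-- The inclusion of the space of `C¹` functions into its closure `V(s)`. -/
def c1Incl (D : Set (E d)) (s : E d) : c1Space D s →ₗ[ℝ] GraphNormed (fiberSpace D s) :=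
  Submodule.inclusion (c1Space D s).le_topologicalClosure

theorem denseRange_c1Incl : DenseRange (c1Incl D s) := by
  refine Metric.denseRange_iff.2 fun v ε hε => ?_
  have h1 : v.pair ∈ closure (c1Space D s : Set (Pairs (domMeasure D))) :=
    (show fiberSpace D s from v).2
  obtain ⟨p, hp, hvp⟩ := Metric.mem_closure_iff.1 h1 ε hε
  exact ⟨⟨p, hp⟩, hvp⟩

/-- The trace operator from `V(s)` to `L₂(Γ₋(s), |n·s|)`, the continuous extension of the
restriction of `C¹` functions. -/
def trace (hDo : IsOpen D) (hDc : Convex ℝ D) (hDb : Bornology.IsBounded D) (hs : ‖s‖ = 1) :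
    GraphNormed (fiberSpace D s) →L[ℝ] L2 (inflowMeasure D s) :=
  (c1Trace hDo hDc hDb hs).extendOfNorm (c1Incl D s)

/-- The trace of a `C¹` function is its restriction. -/
theorem trace_ae_eq (hDo : IsOpen D) (hDc : Convex ℝ D) (hDb : Bornology.IsBounded D)
    (hs : ‖s‖ = 1) (v : GraphNormed (fiberSpace D s)) (hφ : IsC1Test D s φ)
    (hv : Represents D s φ v.pair) : trace hDo hDc hDb hs v =ᵐ[inflowMeasure D s] φ := by
  have hmem : v.pair ∈ c1Space D s :=
    ⟨fiberSpace_le_graphSpace D s (show fiberSpace D s from v).2, φ, hφ, hv⟩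
  have h1 : trace hDo hDc hDb hs v = c1Trace hDo hDc hDb hs ⟨v.pair, hmem⟩ :=
    LinearMap.extendOfNorm_eq denseRange_c1Incl
      ⟨1, fun p => by rw [one_mul]; exact norm_c1Trace_le hDo hDc hDb hs p⟩ ⟨v.pair, hmem⟩
  rw [h1]
  exact c1Trace_ae_eq hDo hDc hDb hs _ hφ hv

end Trace

/-! ### Integrals along rays -/

noncomputable section RayIntegral

/-- Differentiation under the integral sign over a compact interval. -/
theorem contDiff_one_parametric_intervalIntegral {H : Type*} [NormedAddCommGroup H]
    [NormedSpace ℝ H] [FiniteDimensional ℝ H] {F : H × ℝ → ℝ} (hF : ContDiff ℝ 1 F) (a b : ℝ) :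
    ContDiff ℝ 1 fun z => ∫ τ in a..b, F (z, τ) := by
  have : ProperSpace H := FiniteDimensional.proper ℝ H
  set F' : H → ℝ → H →L[ℝ] ℝ := fun z τ =>
    (fderiv ℝ F (z, τ)).comp (ContinuousLinearMap.inl ℝ H ℝ) with hF'
  have hF'c : Continuous (Function.uncurry F') :=
    ((hF.continuous_fderiv one_ne_zero).comp continuous_id).clm_comp continuous_const
  refine contDiff_one_iff_hasFDerivAt.2 ⟨fun z => ∫ τ in a..b, F' z τ,
    intervalIntegral.continuous_parametric_intervalIntegral_of_continuous' hF'c a b, fun z => ?_⟩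
  have hK : IsCompact (Metric.closedBall z 1 ×ˢ uIcc a b) :=
    (isCompact_closedBall z 1).prod isCompact_uIcc
  obtain ⟨C, hC⟩ := hK.exists_bound_of_continuousOn hF'c.continuousOn
  refine (intervalIntegral.hasFDerivAt_integral_of_dominated_of_fderiv_le
    (bound := fun _ => C) (Metric.closedBall_mem_nhds z one_pos)
    (Eventually.of_forall fun y => ?_) ?_ ?_ ?_ intervalIntegrable_const ?_)
  · exact (hF.continuous.comp (by fun_prop : Continuous fun τ : ℝ => (y, τ))).aestronglyMeasurable
  · exact (hF.continuous.comp
      (by fun_prop : Continuous fun τ : ℝ => (z, τ))).intervalIntegrable _ _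
  · exact (hF'c.comp (by fun_prop : Continuous fun τ : ℝ => (z, τ))).aestronglyMeasurable
  · exact Eventually.of_forall fun τ hτ y hy => hC (y, τ) ⟨hy, uIoc_subset_uIcc hτ⟩
  · refine Eventually.of_forall fun τ _ y _ => ?_
    exact ((hF.differentiable one_ne_zero) (y, τ)).hasFDerivAt.comp y (hasFDerivAt_prodMk_left y τ)

variable {d : ℕ} {D : Set (E d)}

/-- The integral `∫_0^R g(x + τ s, s) dτ` along the ray from `x` in direction `s`: the solution
`v` of `-s·∇v = g` that vanishes where the rays leave the support of `g`. -/
def rayIntegral (R : ℝ) (g : E d × E d → ℝ) (z : E d × E d) : ℝ :=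
  ∫ τ in (0 : ℝ)..R, g (z.1 + τ • z.2, z.2)

variable {R : ℝ} {g : E d × E d → ℝ}

theorem contDiff_rayIntegral (hg : ContDiff ℝ 1 g) : ContDiff ℝ 1 (rayIntegral R g) := by
  refine contDiff_one_parametric_intervalIntegral
    (F := fun q : (E d × E d) × ℝ => g (q.1.1 + q.2 • q.1.2, q.1.2)) (hg.comp ?_) 0 R
  fun_prop

/-- The derivative of `t ↦ ∫_t^{t+R} g(x + τ s, s) dτ` at `0`. -/
theorem hasLineDerivAt_rayIntegral (hg : Continuous g) {x s : E d}
    (hx : g (x + R • s, s) = 0) :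
    HasLineDerivAt ℝ (fun y => rayIntegral R g (y, s)) (-g (x, s)) x s := by
  set h : ℝ → ℝ := fun τ => g (x + τ • s, s) with hh
  have hc : Continuous h := hg.comp (by fun_prop)
  have h1 : (fun t : ℝ => rayIntegral R g (x + t • s, s))
      = fun t => (∫ τ in (0 : ℝ)..(t + R), h τ) - ∫ τ in (0 : ℝ)..t, h τ := by
    funext t
    rw [intervalIntegral.integral_interval_sub_left (hc.intervalIntegrable _ _)
      (hc.intervalIntegrable _ _)]
    have h2 := intervalIntegral.integral_comp_add_left (a := 0) (b := R) h t
    rw [add_zero] at h2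
    rw [← h2, rayIntegral]
    refine intervalIntegral.integral_congr fun τ _ => ?_
    simp only [hh, add_smul, add_assoc]
  have hA : ∀ t : ℝ, HasDerivAt (fun t => ∫ τ in (0 : ℝ)..t, h τ) (h t) t := fun t =>
    intervalIntegral.integral_hasDerivAt_right (hc.intervalIntegrable _ _)
      (hc.stronglyMeasurableAtFilter _ _) hc.continuousAt
  have h3 := ((hA (0 + R)).comp_add_const 0 R).sub (hA 0)
  unfold HasLineDerivAt
  rw [h1]
  refine HasDerivAt.congr_deriv h3 ?_
  simp [hh, hx]

/-- A ray starting at a point of `Γ₊(s)` does not meet `D`. -/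
theorem rayIntegral_eq_zero (hgD : ∀ x s, x ∉ D → g (x, s) = 0) (hR : 0 ≤ R) {x s : E d}
    (hx : x ∈ outflow D s) : rayIntegral R g (x, s) = 0 := by
  refine intervalIntegral.integral_zero_ae (Eventually.of_forall fun τ hτ => hgD _ _ fun h => ?_)
  obtain ⟨-, hn, hpos⟩ := hx
  rw [uIoc_of_le hR] at hτ
  have h1 := (isOuterNormal_normal hn).2 _ h
  rw [add_sub_cancel_left, real_inner_smul_right, real_inner_comm] at h1
  exact absurd h1 (not_le.2 (mul_pos hτ.1 hpos))

theorem add_smul_notMem (hDb : Bornology.IsBounded D) {x s : E d} (hs : ‖s‖ = 1) (hx : x ∈ D) :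
    x + (Metric.diam D + 1) • s ∉ D := fun h => by
  have h1 := Metric.dist_le_diam_of_mem hDb h hx
  have h2 : (0 : ℝ) ≤ Metric.diam D := Metric.diam_nonneg
  rw [dist_eq_norm, add_sub_cancel_left, norm_smul, hs, mul_one,
    Real.norm_of_nonneg (by positivity)] at h1
  linarith

/-- Integration by parts against a test function supported in `D`. -/
theorem setIntegral_mul_fderiv {u φ : E d → ℝ} (hu : ContDiff ℝ 1 u) (hφ : ContDiff ℝ ∞ φ)
    (hφc : HasCompactSupport φ) (hφD : tsupport φ ⊆ D) (s : E d) :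
    ∫ x in D, u x * fderiv ℝ φ x s = -∫ x in D, fderiv ℝ u x s * φ x := by
  have hφ0 : ∀ x ∉ D, φ x = 0 := fun x hx => image_eq_zero_of_notMem_tsupport fun h => hx (hφD h)
  have hφ1 : ∀ x ∉ D, fderiv ℝ φ x s = 0 := fun x hx => by
    rw [fderiv_of_notMem_tsupport ℝ fun h => hx (hφD h)]; rfl
  have hu' : Continuous fun x => fderiv ℝ u x s :=
    (hu.continuous_fderiv one_ne_zero).clm_apply continuous_const
  have hφ' : Continuous fun x => fderiv ℝ φ x s :=
    (hφ.continuous_fderiv (by simp)).clm_apply continuous_const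
  rw [setIntegral_eq_integral_of_forall_compl_eq_zero fun x hx => by rw [hφ1 x hx, mul_zero],
    setIntegral_eq_integral_of_forall_compl_eq_zero fun x hx => by rw [hφ0 x hx, mul_zero]]
  refine integral_mul_fderiv_eq_neg_fderiv_mul_of_integrable ?_ ?_ ?_
    (fun x _ => (hu.differentiable one_ne_zero) x) fun x _ => (hφ.differentiable (by simp)) x
  · exact (hu'.mul hφ.continuous).integrable_of_hasCompactSupport hφc.mul_left
  · exact (hu.continuous.mul hφ').integrable_of_hasCompactSupport (hφc.fderiv_apply ℝ s).mul_left
  · exact (hu.continuous.mul hφ.continuous).integrable_of_hasCompactSupport hφc.mul_left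

/-- The weak form of `-s·∇v = g` for the ray integral `v` of `g`. -/
theorem setIntegral_rayIntegral_mul_fderiv (hDo : IsOpen D) (hDb : Bornology.IsBounded D)
    (hg : ContDiff ℝ 1 g) (hgD : ∀ x s, x ∉ D → g (x, s) = 0) {φ : E d → ℝ}
    (hφ : ContDiff ℝ ∞ φ) (hφc : HasCompactSupport φ) (hφD : tsupport φ ⊆ D) {s : E d}
    (hs : ‖s‖ = 1) :
    ∫ x in D, rayIntegral (Metric.diam D + 1) g (x, s) * fderiv ℝ φ x s
      = -∫ x in D, -g (x, s) * φ x := by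
  have hu : ContDiff ℝ 1 fun x => rayIntegral (Metric.diam D + 1) g (x, s) :=
    (contDiff_rayIntegral hg).comp (by fun_prop : ContDiff ℝ 1 fun x : E d => (x, s))
  rw [setIntegral_mul_fderiv hu hφ hφc hφD s]
  congr 1
  refine setIntegral_congr_fun hDo.measurableSet fun x hx => ?_
  have h1 := (hu.differentiable one_ne_zero x).hasFDerivAt.hasLineDerivAt s
  have h2 := hasLineDerivAt_rayIntegral hg.continuous
    (hgD _ s (add_smul_notMem hDb hs hx))
  simp only [h1.unique h2]

end RayIntegral

/-! ### The fiber spaces `V(s)` -/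

noncomputable section Fiber

variable {d : ℕ} {D : Set (E d)} {s : E d} {M : ℝ}

theorem isFiniteMeasure_domMeasure (hDb : Bornology.IsBounded D) :
    IsFiniteMeasure (domMeasure D) :=
  ⟨by rw [Measure.restrict_apply_univ]; exact hDb.measure_lt_top⟩

theorem memLp_domMeasure (hDo : IsOpen D) (hDb : Bornology.IsBounded D) {u : E d → ℝ}
    (hu : Continuous u) : MemLp u 2 (domMeasure D) := by
  have := isFiniteMeasure_domMeasure hDb
  obtain ⟨C, hC⟩ := hDb.isCompact_closure.exists_bound_of_continuousOn hu.continuousOn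
  refine MemLp.of_bound hu.aestronglyMeasurable C ?_
  filter_upwards [ae_restrict_mem hDo.measurableSet] with x hx
  exact hC x (subset_closure hx)

/-- Every test function `g` on `D` is `-s·∇v` for some `v ∈ C¹(closure D)` vanishing on
`Γ₊(s)`. -/
theorem exists_mem_c1Space_snd_eq_neg (hDo : IsOpen D) (hDb : Bornology.IsBounded D) (hs : ‖s‖ = 1)
    {g : E d → ℝ} (hg : ContDiff ℝ ∞ g) (hgD : tsupport g ⊆ D) :
    ∃ p ∈ c1Space D s, p.snd =ᵐ[domMeasure D] -g := by
  set G : E d × E d → ℝ := fun z => g z.1 with hGdef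
  have hG : ContDiff ℝ 1 G := (hg.of_le (by simp)).comp contDiff_fst
  have hGD : ∀ x s : E d, x ∉ D → G (x, s) = 0 := fun x _ hx =>
    image_eq_zero_of_notMem_tsupport (f := g) fun h => hx (hgD h)
  set u : E d → ℝ := fun x => rayIntegral (Metric.diam D + 1) G (x, s) with hu_def
  have hu : ContDiff ℝ 1 u :=
    (contDiff_rayIntegral hG).comp (by fun_prop : ContDiff ℝ 1 fun x : E d => (x, s))
  have hum := memLp_domMeasure hDo hDb hu.continuous
  have hgm := memLp_domMeasure hDo hDb hg.continuous.neg
  refine ⟨Pairs.mk hum.toLp hgm.toLp, ⟨fun φ h1 h2 h3 => ?_, u,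
    ⟨hu.contDiffOn, fun x hx => rayIntegral_eq_zero hGD
      (by have : (0 : ℝ) ≤ Metric.diam D := Metric.diam_nonneg
          positivity) hx⟩, hum.coeFn_toLp, ?_⟩, hgm.coeFn_toLp⟩
  · have e1 : pairing (fun x => fderiv ℝ φ x s) hum.toLp = ∫ x in D, u x * fderiv ℝ φ x s :=
      integral_congr_ae (hum.coeFn_toLp.mono fun x hx => by simp only [hx])
    have e2 : pairing φ hgm.toLp = ∫ x in D, -g x * φ x :=
      integral_congr_ae (hgm.coeFn_toLp.mono fun x hx => by simp only [hx, Pi.neg_apply])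
    rw [Pairs.fst_mk, Pairs.snd_mk, e1, e2]
    exact setIntegral_rayIntegral_mul_fderiv hDo hDb hG hGD h1 h2 h3 hs
  · filter_upwards [hgm.coeFn_toLp, ae_restrict_mem hDo.measurableSet] with x hx hxD
    rw [Pairs.snd_mk, hx]
    exact hasLineDerivAt_rayIntegral hG.continuous (hGD _ s (add_smul_notMem hDb hs hxD))

theorem isClosed_poincare {X : Type*} [MeasurableSpace X] {μ : Measure X} {σ : X → ℝ}
    (hσ : MemLp σ ∞ μ) (K : ℝ) :
    IsClosed {p : Pairs μ | ‖p.fst‖ ≤ K * ‖adjTransport hσ p‖} :=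
  isClosed_le Pairs.fstL.continuous.norm ((adjTransport hσ).continuous.norm.const_mul K)

/-- The Poincaré constant `2 diam D` depends neither on the direction nor on the cross section. -/
theorem isTransportSpace_fiberSpace (hDo : IsOpen D) (hDc : Convex ℝ D)
    (hDb : Bornology.IsBounded D) (hs : ‖s‖ = 1) :
    IsTransportSpace M (2 * Metric.diam D) (fiberSpace D s) where
  nonneg := mul_nonneg zero_le_two Metric.diam_nonneg
  closed := (c1Space D s).isClosed_topologicalClosure
  poincare {σ} h p hp := by
    refine closure_minimal (fun p hp => ?_) (isClosed_poincare h.memLp _) hp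
    obtain ⟨-, φ, hφ, hφp⟩ := hp
    refine norm_le_of_lintegral_sq_le Metric.diam_nonneg ?_
    refine (hφ.lintegral_sq_le_of_ae hDo hDc hDb hs hφp.1 hφp.2
      (h.2.mono fun x hx => hx.1)).trans_eq ?_
    congr 1
    refine lintegral_congr_ae ?_
    filter_upwards [adjTransport_coeFn h.memLp p] with x hx
    rw [hx]
  dense w hw := by
    have hfin := isFiniteMeasure_domMeasure hDb
    refine Lp.ext ?_
    have h1 := hDo.ae_eq_zero_of_integral_contDiff_smul_eq_zero (μ := domMeasure D) (f := w)
      (((Lp.memLp w).integrable (by norm_num)).locallyIntegrable.locallyIntegrableOn _)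
      fun g hg _ hgD => by
        obtain ⟨p, hp, hpg⟩ := exists_mem_c1Space_snd_eq_neg hDo hDb hs hg hgD
        have h2 := hw p ((c1Space D s).le_topologicalClosure hp)
        rw [L2.inner_def, ← neg_eq_zero, ← integral_neg] at h2
        rw [← h2]
        refine integral_congr_ae ?_
        filter_upwards [hpg] with x hx
        rw [hx]
        simp
    filter_upwards [h1, ae_restrict_mem hDo.measurableSet, Lp.coeFn_zero ℝ 2 (domMeasure D)]
      with x h1 h2 h3
    rw [h1 h2, h3]; rfl

end Fiber

/-! ### The lifted space `V` -/

noncomputable section Lifted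

variable {d : ℕ} {D : Set (E d)} {M : ℝ}

theorem ae_fiber_of_ae {P : E d × Sph d → Prop} (h : ∀ᵐ q ∂phaseMeasure D, P q) :
    ∀ᵐ s ∂sphMeasure d, ∀ᵐ x ∂domMeasure D, P (x, s) :=
  Measure.ae_ae_of_ae_prod (p := fun q : Sph d × E d => P (q.2, q.1))
    (Measure.measurePreserving_swap.quasiMeasurePreserving.ae h)

theorem ae_isCrossSection {σ : E d × Sph d → ℝ} (hσ : IsCrossSection (phaseMeasure D) M σ) :
    ∀ᵐ s ∂sphMeasure d, IsCrossSection (domMeasure D) M fun x => σ (x, s) := by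
  filter_upwards [ae_fiber_of_ae hσ.2, hσ.1.prod_swap.prodMk_left] with s h1 h2
  exact ⟨h2, h1⟩

theorem ae_phaseMeasure_mem (hDo : IsOpen D) : ∀ᵐ q ∂phaseMeasure D, q.1 ∈ D :=
  Measure.quasiMeasurePreserving_fst.ae (ae_restrict_mem hDo.measurableSet)

theorem isFiniteMeasure_phaseMeasure (hDb : Bornology.IsBounded D) :
    IsFiniteMeasure (phaseMeasure D) := by
  have := isFiniteMeasure_domMeasure hDb
  infer_instance

theorem memLp_phaseMeasure (hDo : IsOpen D) (hDb : Bornology.IsBounded D) {u : E d × E d → ℝ}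
    (hu : Continuous u) :
    MemLp (fun q : E d × Sph d => u (q.1, (q.2 : E d))) 2 (phaseMeasure D) := by
  have := isFiniteMeasure_phaseMeasure hDb
  obtain ⟨C, hC⟩ := (hDb.isCompact_closure.prod (isCompact_sphere (0 : E d) 1)
    ).exists_bound_of_continuousOn hu.continuousOn
  refine MemLp.of_bound (hu.comp (by fun_prop)).aestronglyMeasurable C ?_
  filter_upwards [ae_phaseMeasure_mem hDo] with q hq
  exact hC _ ⟨subset_closure hq, q.2.2⟩

theorem norm_coe_sph (s : Sph d) : ‖(s : E d)‖ = 1 := by simp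

/-- The directional derivative in the space variable alone. -/
theorem fderiv_partial {φ : E d × E d → ℝ} (hφ : Differentiable ℝ φ) (x s v : E d) :
    fderiv ℝ φ (x, s) (v, 0) = fderiv ℝ (fun y => φ (y, s)) x v := by
  have h1 : HasFDerivAt (fun y => φ (y, s))
      ((fderiv ℝ φ (x, s)).comp (ContinuousLinearMap.inl ℝ (E d) (E d))) x :=
    (hφ (x, s)).hasFDerivAt.comp x (hasFDerivAt_prodMk_left x s)
  rw [h1.fderiv]
  rfl

/-- Every test function `g` on `D × ℝᵈ` is `-s·∇v` for some `v ∈ C¹(closure (D × S))` vanishing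
on `Γ₊`. -/
theorem exists_mem_liftedC1Space_snd_eq_neg (hDo : IsOpen D) (hDb : Bornology.IsBounded D)
    {g : E d × E d → ℝ} (hg : ContDiff ℝ ∞ g) (hgD : tsupport g ⊆ D ×ˢ univ) :
    ∃ p ∈ liftedC1Space D,
      p.snd =ᵐ[phaseMeasure D] fun q => -g (q.1, (q.2 : E d)) := by
  have hfin := isFiniteMeasure_domMeasure hDb
  have hG : ContDiff ℝ 1 g := hg.of_le (by simp)
  have hGD : ∀ x s : E d, x ∉ D → g (x, s) = 0 := fun x s hx =>
    image_eq_zero_of_notMem_tsupport fun h => hx (hgD h).1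
  set u : E d × E d → ℝ := rayIntegral (Metric.diam D + 1) g with hu_def
  have hu : ContDiff ℝ 1 u := contDiff_rayIntegral hG
  have hum := memLp_phaseMeasure hDo hDb hu.continuous
  have hgm := memLp_phaseMeasure hDo hDb hg.continuous.neg
  refine ⟨Pairs.mk hum.toLp hgm.toLp, ⟨fun φ h1 h2 h3 => ?_, u,
    ⟨hu.contDiffOn, fun s _ x hx => rayIntegral_eq_zero hGD
      (by have : (0 : ℝ) ≤ Metric.diam D := Metric.diam_nonneg
          positivity) hx⟩, hum.coeFn_toLp, ?_⟩, hgm.coeFn_toLp⟩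
  · have m1 := memLp_deriv_restrict_sphere D h1 h2
    have m2 := memLp_restrict_sphere D h1.continuous h2
    have i1 := integral_prod_symm _ ((Lp.memLp hum.toLp).integrable_mul m1)
    have i2 := integral_prod_symm _ ((Lp.memLp hgm.toLp).integrable_mul m2)
    refine i1.trans (Eq.trans ?_ (congrArg Neg.neg i2).symm)
    rw [← integral_neg]
    refine integral_congr_ae ?_
    filter_upwards [ae_fiber_of_ae hum.coeFn_toLp, ae_fiber_of_ae hgm.coeFn_toLp] with s k1 k2
    have hemb : IsClosedEmbedding fun x : E d => (x, (s : E d)) :=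
      .of_continuous_injective_isClosedMap (by fun_prop) (fun x y h => (Prod.ext_iff.1 h).1)
        (by
          intro K hK
          have : (fun x : E d => (x, (s : E d))) '' K = K ×ˢ {(s : E d)} := by
            ext ⟨a, b⟩; simp [eq_comm, and_comm]
          rw [this]; exact hK.prod isClosed_singleton)
    have hφs : ContDiff ℝ ∞ fun x : E d => φ (x, (s : E d)) :=
      h1.comp (by fun_prop : ContDiff ℝ ∞ fun x : E d => (x, (s : E d)))
    have hφD : tsupport (fun x : E d => φ (x, (s : E d))) ⊆ D := fun x hx =>
      (h3 (closure_minimal (t := (fun x : E d => (x, (s : E d))) ⁻¹' tsupport φ)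
        (fun y hy => subset_tsupport φ hy)
        ((isClosed_tsupport φ).preimage hemb.continuous) hx)).1
    have hparts := setIntegral_rayIntegral_mul_fderiv hDo hDb hG hGD hφs
      (h2.comp_isClosedEmbedding hemb) hφD (norm_coe_sph s)
    refine Eq.trans (integral_congr_ae ?_) (hparts.trans (congrArg Neg.neg
      (integral_congr_ae ?_)))
    · filter_upwards [k1] with x hx
      rw [Pi.mul_apply, hx, fderiv_partial (h1.differentiable (by simp))]
    · filter_upwards [k2] with x hx
      rw [Pi.mul_apply, hx]
      rfl
  · filter_upwards [hgm.coeFn_toLp, ae_phaseMeasure_mem hDo] with q hx hxD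
    rw [Pairs.snd_mk, hx]
    exact hasLineDerivAt_rayIntegral hg.continuous
      (hGD _ _ (add_smul_notMem hDb (norm_coe_sph q.2) hxD))

theorem IsLiftedC1Test.fiber {φ : E d × E d → ℝ} (hφ : IsLiftedC1Test D φ) (s : Sph d) :
    IsC1Test D (s : E d) fun x => φ (x, (s : E d)) :=
  ⟨hφ.1.comp (by fun_prop : ContDiff ℝ 1 fun x : E d => (x, (s : E d))).contDiffOn
    fun _ hx => ⟨hx, s.2⟩, hφ.2 s s.2⟩

/-- The Poincaré inequality on `D × S` is the fiber inequality integrated over the directions, with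
the same constant. -/
theorem isTransportSpace_liftedSpace (hDo : IsOpen D) (hDc : Convex ℝ D)
    (hDb : Bornology.IsBounded D) :
    IsTransportSpace M (2 * Metric.diam D) (liftedSpace D) where
  nonneg := mul_nonneg zero_le_two Metric.diam_nonneg
  closed := (liftedC1Space D).isClosed_topologicalClosure
  poincare {σ} h p hp := by
    have hfin := isFiniteMeasure_domMeasure hDb
    refine closure_minimal (fun p hp => ?_) (isClosed_poincare h.memLp _) hp
    obtain ⟨-, φ, hφ, hφp⟩ := hp
    refine norm_le_of_lintegral_sq_le Metric.diam_nonneg ?_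
    have m1 := (Lp.aestronglyMeasurable p.fst).aemeasurable
    have m2 := (Lp.aestronglyMeasurable (adjTransport h.memLp p)).aemeasurable
    have i1 := lintegral_prod_symm _ (m1.pow_const 2).ennreal_ofReal
    have i2 := lintegral_prod_symm _ ((m1.const_mul 2).mul m2).ennreal_ofReal
    simp only [Pi.mul_apply] at i1 i2
    rw [i1, i2, ← lintegral_const_mul' _ _ ENNReal.ofReal_ne_top]
    refine lintegral_mono_ae ?_
    filter_upwards [ae_fiber_of_ae hφp.1, ae_fiber_of_ae hφp.2, ae_fiber_of_ae h.2,
      ae_fiber_of_ae (adjTransport_coeFn h.memLp p)] with s h1 h2 h3 h4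
    refine ((hφ.fiber s).lintegral_sq_le_of_ae hDo hDc hDb (norm_coe_sph s) h1 h2
      (h3.mono fun x hx => hx.1)).trans_eq ?_
    congr 1
    refine lintegral_congr_ae ?_
    filter_upwards [h4] with x hx
    rw [hx]
  dense w hw := by
    have hfin := isFiniteMeasure_phaseMeasure hDb
    set ι : E d × Sph d → E d × E d := fun q => (q.1, (q.2 : E d)) with hι
    have hemb : IsClosedEmbedding ι :=
      IsClosedEmbedding.id.prodMap Metric.isClosed_sphere.isClosedEmbedding_subtypeVal
    have hme := hemb.measurableEmbedding
    -- the test functions live on `D × ℝᵈ`, so `w` is moved to the image measure there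
    set w' : E d × E d → ℝ := Function.extend ι w 0 with hw'
    have hw'ι : ∀ q, w' (ι q) = w q := fun q => hemb.injective.extend_apply _ _ q
    have hint : Integrable w' ((phaseMeasure D).map ι) := by
      rw [hme.integrable_map_iff, show w' ∘ ι = w from funext hw'ι]
      exact (Lp.memLp w).integrable (by norm_num)
    have h1 := (hDo.prod isOpen_univ).ae_eq_zero_of_integral_contDiff_smul_eq_zero
      (μ := (phaseMeasure D).map ι) (f := w')
      (hint.locallyIntegrable.locallyIntegrableOn _) fun g hg _ hgD => by
        obtain ⟨p, hp, hpg⟩ := exists_mem_liftedC1Space_snd_eq_neg hDo hDb hg hgD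
        have h2 := hw p ((liftedC1Space D).le_topologicalClosure hp)
        rw [L2.inner_def, ← neg_eq_zero, ← integral_neg] at h2
        rw [hme.integral_map, ← h2]
        refine integral_congr_ae ?_
        filter_upwards [hpg] with q hq
        rw [hq, hw'ι]
        simp [hι]
    rw [hme.ae_map_iff] at h1
    refine Lp.ext ?_
    filter_upwards [h1, ae_phaseMeasure_mem hDo, Lp.coeFn_zero ℝ 2 (phaseMeasure D)]
      with q h1 h2 h3
    rw [← hw'ι, h1 ⟨h2, mem_univ _⟩, h3]; rfl

end Lifted

/-! ### Nontriviality of the measures -/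

section Nontriviality

variable {d : ℕ} {D : Set (E d)}

theorem domMeasure_ne_zero (hDne : D.Nonempty) (hDo : IsOpen D) : domMeasure D ≠ 0 := by
  rw [Ne, Measure.restrict_eq_zero]
  exact (hDo.measure_pos volume hDne).ne'

theorem phaseMeasure_ne_zero (hd : 1 ≤ d) (hDne : D.Nonempty) (hDo : IsOpen D) :
    phaseMeasure D ≠ 0 := by
  have : Nonempty (Fin d) := ⟨⟨0, hd⟩⟩
  have h1 : sphMeasure d ≠ 0 := Measure.toSphere_ne_zero _
  rw [← Measure.measure_univ_ne_zero, ← univ_prod_univ, Measure.prod_prod]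
  exact mul_ne_zero (Measure.measure_univ_ne_zero.2 (domMeasure_ne_zero hDne hDo))
    (Measure.measure_univ_ne_zero.2 h1)

end Nontriviality

/-! ### Inflow data -/

noncomputable section InflowData

variable {X Y : Type*} [MeasurableSpace X] [MeasurableSpace Y] {μ : Measure X} {ν : Measure Y}
  {M K : ℝ} {V : Submodule ℝ (Pairs μ)}

/-- The solution operator for a functional `f` and inflow data `g`: the inflow data act on `V`
through the transpose of the trace operator. -/
theorem IsTransportSpace.exists_solve_inflow (hV : IsTransportSpace M K V) {σ : X → ℝ}
    (h : IsCrossSection μ M σ) (tr : GraphNormed V →L[ℝ] L2 ν) :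
    ∃ S : StrongDual ℝ (GraphNormed V) × L2 ν →L[ℝ] L2 μ,
      ∀ f g u, (∀ v : GraphNormed V,
        transportForm σ u v.pair = -(∫ x, g x * tr v x ∂ν) + f v) ↔ u = S (f, g) := by
  set P : L2 ν →L[ℝ] StrongDual ℝ (GraphNormed V) :=
    (ContinuousLinearMap.precomp ℝ tr).comp (innerSL ℝ (E := L2 ν)) with hP
  have hPg : ∀ g v, P g v = ∫ x, g x * tr v x ∂ν := fun g v => by
    change inner ℝ g (tr v) = _
    rw [L2.inner_def]
    simp [mul_comm]
  refine ⟨(hV.solve h).comp (ContinuousLinearMap.fst ℝ _ _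
    - P.comp (ContinuousLinearMap.snd ℝ _ _)), fun f g u => ?_⟩
  have h1 := hV.transportForm_eq_iff h (f - P g) u
  refine Iff.trans (forall_congr' fun v => ?_) h1
  have h2 : (f - P g) v = f v - P g v := rfl
  rw [h2, hPg, neg_add_eq_sub]

end InflowData

end RadTransport

theorem mainTheorem5 {d : ℕ} (hd : 1 ≤ d) (D : Set (E d)) (hDne : D.Nonempty) (hDo : IsOpen D)
    (hDc : Convex ℝ D) (hDb : Bornology.IsBounded D)
    (M : ℝ) (σ : E d × Sph d → ℝ) (hσ : IsCrossSection (phaseMeasure D) M σ) :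
    ∃ c C : ℝ, 0 < c ∧ 0 < C ∧
      -- the fibers of `σ` are cross sections on `D` for almost every direction
      (∀ᵐ s ∂sphMeasure d, IsCrossSection (domMeasure D) M fun x => σ (x, s)) ∧
      -- the fiber problems
      (∀ (s : Sph d) (hs : IsCrossSection (domMeasure D) M fun x => σ (x, s)),
        -- `‖T_s^* v‖` is a norm, equivalent to the graph norm on `V(s)`
        (∀ v ∈ fiberSpace D (s : E d),
          c * ‖v‖ ≤ ‖adjTransport hs.memLp v‖ ∧ ‖adjTransport hs.memLp v‖ ≤ C * ‖v‖) ∧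
        -- bounded invertibility with respect to the graph norm
        (∃ A : L2 (domMeasure D) ≃L[ℝ] StrongDual ℝ (GraphNormed (fiberSpace D (s : E d))),
          (∀ w, A w = transportOp hs.memLp (fiberSpace D (s : E d)) w) ∧
            ‖transportOp hs.memLp (fiberSpace D (s : E d))‖ ≤ C ∧
            ‖A.symm.toContinuousLinearMap‖ ≤ c⁻¹) ∧
        -- isometric isomorphism with respect to the norm `‖T_s^* v‖`
        (∃ A : L2 (domMeasure D) ≃ₗᵢ[ℝ]
            StrongDual ℝ (StarNormed hs.memLp (fiberSpace D (s : E d))),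
          (∀ w, A w = transportOpStar hs.memLp (fiberSpace D (s : E d)) w) ∧
            condNumber A.toContinuousLinearEquiv = 1) ∧
        -- unique solvability for all right hand sides in `V(s)'`
        (∃ S : StrongDual ℝ (GraphNormed (fiberSpace D (s : E d))) →L[ℝ] L2 (domMeasure D),
          ‖S‖ ≤ c⁻¹ ∧
          ∀ F u, (∀ v, transportForm (fun x => σ (x, s)) u v.pair = F v) ↔ u = S F) ∧
        -- unique solvability for data `f ∈ V(s)'` and inflow data `g ∈ L₂(Γ₋(s), |n·s|)`
        (∃ tr : GraphNormed (fiberSpace D (s : E d)) →L[ℝ] L2 (inflowMeasure D (s : E d)),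
          -- `tr v` is the trace of `v` on `Γ₋(s)`
          (∀ v φ, IsC1Test D (s : E d) φ → Represents D (s : E d) φ v.pair →
            tr v =ᵐ[inflowMeasure D (s : E d)] φ) ∧
          ∃ S : StrongDual ℝ (GraphNormed (fiberSpace D (s : E d))) ×
              L2 (inflowMeasure D (s : E d)) →L[ℝ] L2 (domMeasure D),
            -- on `Γ₋(s)` one has `n·s = -|n·s|`
            ∀ f g u, (∀ v, transportForm (fun x => σ (x, s)) u v.pair
              = -(∫ x, g x * tr v x ∂inflowMeasure D (s : E d)) + f v) ↔ u = S (f, g))) ∧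
      -- the lifted problem: `‖T^* v‖` is a norm, equivalent to the graph norm on `V`
      (∀ v ∈ liftedSpace D,
        c * ‖v‖ ≤ ‖adjTransport hσ.memLp v‖ ∧ ‖adjTransport hσ.memLp v‖ ≤ C * ‖v‖) ∧
      -- bounded invertibility with respect to the graph norm
      (∃ A : L2 (phaseMeasure D) ≃L[ℝ] StrongDual ℝ (GraphNormed (liftedSpace D)),
        (∀ w, A w = transportOp hσ.memLp (liftedSpace D) w) ∧
          ‖transportOp hσ.memLp (liftedSpace D)‖ ≤ C ∧
          ‖A.symm.toContinuousLinearMap‖ ≤ c⁻¹) ∧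
      -- isometric isomorphism with respect to the norm `‖T^* v‖`
      (∃ A : L2 (phaseMeasure D) ≃ₗᵢ[ℝ] StrongDual ℝ (StarNormed hσ.memLp (liftedSpace D)),
        (∀ w, A w = transportOpStar hσ.memLp (liftedSpace D) w) ∧
          condNumber A.toContinuousLinearEquiv = 1) ∧
      -- unique solvability for all right hand sides in `V'`
      (∃ S : StrongDual ℝ (GraphNormed (liftedSpace D)) →L[ℝ] L2 (phaseMeasure D), ‖S‖ ≤ c⁻¹ ∧
        ∀ F u, (∀ v, transportForm σ u v.pair = F v) ↔ u = S F) := by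
  have hR : (0 : ℝ) ≤ 2 * Metric.diam D := mul_nonneg zero_le_two Metric.diam_nonneg
  have hfd := isFiniteMeasure_domMeasure hDb
  have hfp := isFiniteMeasure_phaseMeasure hDb
  have hnd := nontrivial_L2 (domMeasure_ne_zero hDne hDo)
  have hnp := nontrivial_L2 (phaseMeasure_ne_zero hd hDne hDo)
  have hL : IsTransportSpace M (2 * Metric.diam D) (liftedSpace D) :=
    isTransportSpace_liftedSpace hDo hDc hDb
  refine ⟨coercivityConst (2 * Metric.diam D) M, 1 + |M|, coercivityConst_pos hR M,
    by positivity, ae_isCrossSection hσ, fun s hs => ?_,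
    fun v hv => ⟨coercivityConst_mul_norm_le hσ hR (hL.poincare hσ v hv),
      norm_adjTransport_le hσ v⟩,
    hL.exists_inverse hσ, hL.exists_isometry hσ,
    hL.solve hσ, hL.norm_solve_le hσ, hL.transportForm_eq_iff hσ⟩
  have hF : IsTransportSpace M (2 * Metric.diam D) (fiberSpace D (s : E d)) :=
    isTransportSpace_fiberSpace hDo hDc hDb (norm_coe_sph s)
  exact ⟨fun v hv => ⟨coercivityConst_mul_norm_le hs hR (hF.poincare hs v hv),
      norm_adjTransport_le hs v⟩,
    hF.exists_inverse hs, hF.exists_isometry hs,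
    ⟨hF.solve hs, hF.norm_solve_le hs, hF.transportForm_eq_iff hs⟩,
    trace hDo hDc hDb (norm_coe_sph s),
    fun v φ hφ hv => trace_ae_eq hDo hDc hDb (norm_coe_sph s) v hφ hv,
    hF.exists_solve_inflow hs _⟩
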